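/- A convex body in $\mathbb{R}^n$ is a compact convex set with non-empty interior; it is centrally symmetric if $-K=K$. For a centrally symmetric convex body $K$ put $\|x\|_K=\inf\{r>0:x\in rK\}$ and $M(K)=\int_{S^{n-1}}\|\xi\|_K\,d\sigma(\xi)$, where $\sigma$ is the rotationally invariant probability measure on the sphere. Let $T_2(X_K)=\sup_k T_{2,k}(X_K)$ be the type-2 constant of the normed space with unit ball $K$, where $T_{2,k}(X_K)$ is the least $T\geqslant 0$ such that $\big(\mathbb{E}_\epsilon\|\sum_{i=1}^k\epsilon_ix_i\|_K^2\big)^{1/2}\leqslant T\big(\sum_{i=1}^k\|x_i\|_K^2\big)^{1/2}$ for all $x_1,\dots,x_k\in\mathbb{R}^n$, the $\epsilon_i$ being independent uniform signs. A convex body $C$ is isotropic, with isotropic constant $L_C>0$, if it has volume $1$, its barycenter is $0$, and $\int_C\langle x,\xi\rangle^2dx=L_C^2$ for all $\xi\in S^{n-1}$. For ${\bf t}=(t_1,\dots,t_s)\in\mathbb{R}^s$ and a convex body $C$ of volume $1$ put $$\|{\bf t}\|_{C^s,K}=\int_C\cdots\int_C\Big\|\sum_{j=1}^st_jx_j\Big\|_K\,dx_1\cdots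 dx_s .$$ Theorem. There are absolute constants $c_1,c_2>0$ such that the following hold for all $n\geqslant 1$. (a) Let $C$ be an isotropic centrally symmetric convex body in $\mathbb{R}^n$ and $K$ a centrally symmetric convex body in $\mathbb{R}^n$. Then for all $s\geqslant 1$ and ${\bf t}\in\mathbb{R}^s$, $$\frac{c_1L_C\sqrt{n}\,M(K)}{T_2(X_K)}\,\|{\bf t}\|_2\leqslant\|{\bf t}\|_{C^s,K}\leqslant c_2T_2(X_K)\Big(\int_C\|x\|_K\,dx\Big)\|{\bf t}\|_2 .$$ (b) Let $K$ be a centrally symmetric convex body of volume $1$ in $\mathbb{R}^n$. Then $K$ has an isotropic linear image, and for every isotropic image $K_{\rm iso}=T(K)$, with $T$ an invertible linear map, for all $s\geqslant 1$ and ${\bf t}\in\mathbb{R}^s$, $$\frac{c_1L_{K_{\rm iso}}\sqrt{n}\,M(K_{\rm iso})}{T_2(X_K)}\,\|{\bf t}\|_2\leqslant\|{\bf t}\|_{K^s,K}\leqslant c_2T_2(X_K)\,\|{\bf t}\|_2 .$$ In particular, if $K$ itself is isotropic, this holds with $K_{\rm iso}=K$. -/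

import Mathlib

open MeasureTheory
open scoped Pointwise

/-- A convex body in `ℝⁿ`: a compact convex set with non-empty interior. -/
structure IsConvexBodyIn {n : ℕ} (C : Set (EuclideanSpace ℝ (Fin n))) : Prop where
  isCompact : IsCompact C
  convex : Convex ℝ C
  interior_nonempty : (interior C).Nonempty

/-- A centrally symmetric convex body: a convex body `C` with `-C = C`. -/
structure IsSymmConvexBody {n : ℕ} (C : Set (EuclideanSpace ℝ (Fin n))) : Prop
    extends IsConvexBodyIn C where
  neg_eq : -C = C

/-- `C` is an isotropic convex body in `ℝⁿ` with isotropic constant `L_C = L`: it has volume `1`,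
its barycenter is the origin, and `∫_C ⟨x, ξ⟩² dx = L²` for every unit vector `ξ`. For `n ≥ 1` the
number `L` is determined by `C`. -/
structure IsIsotropicWith {n : ℕ} (C : Set (EuclideanSpace ℝ (Fin n))) (L : ℝ) : Prop
    extends IsConvexBodyIn C where
  volume_eq_one : volume C = 1
  barycenter_eq_zero : ∫ x in C, x = 0
  const_pos : 0 < L
  second_moment : ∀ ξ : EuclideanSpace ℝ (Fin n), ‖ξ‖ = 1 → ∫ x in C, (inner ℝ x ξ) ^ 2 = L ^ 2

/-- `M(K)`: the average of `‖ξ‖_K` over the unit sphere with respect to the rotationally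
invariant probability measure (the normalization of the surface measure). -/
noncomputable def sphereMean {n : ℕ} (K : Set (EuclideanSpace ℝ (Fin n))) : ℝ :=
  ⨍ ξ, gauge K (ξ : EuclideanSpace ℝ (Fin n))
    ∂(volume : Measure (EuclideanSpace ℝ (Fin n))).toSphere

/-- `𝔼_ε ‖∑ εᵢ xᵢ‖_K²`, for independent uniformly distributed signs `εᵢ ∈ {1, -1}`. -/
noncomputable def rademacherSq {n : ℕ} (K : Set (EuclideanSpace ℝ (Fin n))) {k : ℕ}
    (x : Fin k → EuclideanSpace ℝ (Fin n)) : ℝ :=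
  (∑ ε : Fin k → ℤˣ, gauge K (∑ i, ((ε i : ℤ) : ℝ) • x i) ^ 2) / 2 ^ k

/-- `T_{2,k}(X_K)`: the best constant in the type-2 inequality for `k` vectors of the normed
space with unit ball `K`. -/
noncomputable def typeTwoConstOn {n : ℕ} (K : Set (EuclideanSpace ℝ (Fin n))) (k : ℕ) : ℝ :=
  sInf {T : ℝ | 0 ≤ T ∧ ∀ x : Fin k → EuclideanSpace ℝ (Fin n),
    Real.sqrt (rademacherSq K x) ≤ T * Real.sqrt (∑ i, gauge K (x i) ^ 2)}

/-- The type-2 constant `T_2(X_K) = sup_k T_{2,k}(X_K)`. -/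
noncomputable def typeTwoConst {n : ℕ} (K : Set (EuclideanSpace ℝ (Fin n))) : ℝ :=
  ⨆ k : ℕ, typeTwoConstOn K k

/-- `‖t‖_{𝒞,K}` for `𝒞 = (C₁, …, C_s)`: the average of `‖∑ tⱼ xⱼ‖_K` over
`(x₁, …, x_s) ∈ C₁ × ⋯ × C_s`. -/
noncomputable def multiIntegralNorm {n s : ℕ} (C : Fin s → Set (EuclideanSpace ℝ (Fin n)))
    (K : Set (EuclideanSpace ℝ (Fin n))) (t : EuclideanSpace ℝ (Fin s)) : ℝ :=
  (∏ j, volume.real (C j))⁻¹ *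
    ∫ x : Fin s → EuclideanSpace ℝ (Fin n) in Set.univ.pi C, gauge K (∑ j, t j • x j)

/-! Let `Y = ∑ tⱼ xⱼ` with `xⱼ` independent and uniform on `C`; both bounds compare first and second
moments of `‖Y‖_K`.

Upper bound: since `-C = C`, random signs can be inserted, and type 2 gives `𝔼‖Y‖_K² ≤ T₂² ‖t‖² ∫_C
‖x‖_K²` (`sq_multiIntegralNorm_le`). A reverse Hölder inequality replaces the last integral by `(∫_C
‖x‖_K)²`; when `C = K` it is at most `1`.

Lower bound: `Y` has covariance `L²‖t‖² Id`. By Carathéodory, finitely many weighted points have the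
same covariance and the same `𝔼‖·‖_K²`; scaled by the square roots of their weights they form a
tight frame `z_k`. Then `∑ g_k z_k`, with independent standard Gaussian `g_k`, is distributed as
`L‖t‖ G`, `G` standard Gaussian in `ℝⁿ`, so type 2 yields `L²‖t‖² 𝔼‖G‖_K² ≤ T₂² 𝔼‖Y‖_K²`. In polar
coordinates `𝔼‖G‖_K²` is `n` times the spherical mean of `‖ξ‖_K²`, hence at least `n M(K)²`. Reverse
Hölder, now on `Cˢ`, returns to the first moment.

Reverse Hölder (`MidpointPrekopaLeindler.integral_sq_le`) comes from Prékopa–Leindler: proved on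
`ℝ`, it passes to products and to convex restrictions, and gives Borell's tail estimate.

Part (b) follows by linear invariance of both the averaged norm and the type-2 constant. -/

/-- The Prékopa–Leindler inequality with equal weights. -/
def MidpointPrekopaLeindler {E : Type*} [AddCommGroup E] [Module ℝ E] [MeasurableSpace E]
    (μ : Measure E) : Prop :=
  ∀ f g h : E → ENNReal, Measurable f → Measurable g → Measurable h →
    (∀ x y, f x * g y ≤ h ((1 / 2 : ℝ) • (x + y)) ^ 2) →
    (∫⁻ x, f x ∂μ) * ∫⁻ x, g x ∂μ ≤ (∫⁻ x, h x ∂μ) ^ 2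

/-! ### Stability of Prékopa–Leindler under products and convex restriction. -/

namespace MidpointPrekopaLeindler

variable {E F : Type*} [AddCommGroup E] [Module ℝ E] [MeasurableSpace E]
  [AddCommGroup F] [Module ℝ F] [MeasurableSpace F]

/-- The inequality for `ν` on fibres says exactly that the fibre integrals satisfy the hypothesis of
the inequality for `μ`. -/
theorem prod {μ : Measure E} {ν : Measure F} [SFinite μ] [SFinite ν]
    (hμ : MidpointPrekopaLeindler μ) (hν : MidpointPrekopaLeindler ν) :
    MidpointPrekopaLeindler (μ.prod ν) := by
  intro f g h hf hg hh H
  rw [lintegral_prod _ hf.aemeasurable, lintegral_prod _ hg.aemeasurable,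
    lintegral_prod _ hh.aemeasurable]
  refine hμ _ _ _ hf.lintegral_prod_right' hg.lintegral_prod_right' hh.lintegral_prod_right' ?_
  intro x y
  exact hν _ _ _ (hf.comp measurable_prodMk_left) (hg.comp measurable_prodMk_left)
    (hh.comp measurable_prodMk_left) fun u v => H (x, u) (y, v)

theorem of_measurePreserving {μ : Measure E} {ν : Measure F} (hμ : MidpointPrekopaLeindler μ)
    {e : E → F} (he : MeasurePreserving e μ ν)
    (hmid : ∀ x y, e ((1 / 2 : ℝ) • (x + y)) = (1 / 2 : ℝ) • (e x + e y)) :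
    MidpointPrekopaLeindler ν := by
  intro f g h hf hg hh H
  rw [← he.lintegral_comp hf, ← he.lintegral_comp hg, ← he.lintegral_comp hh]
  refine hμ _ _ _ (hf.comp he.measurable) (hg.comp he.measurable) (hh.comp he.measurable) ?_
  intro x y
  rw [hmid]
  exact H _ _

theorem restrict {μ : Measure E} (hμ : MidpointPrekopaLeindler μ) {C : Set E} (hC : Convex ℝ C)
    (hCm : MeasurableSet C) : MidpointPrekopaLeindler (μ.restrict C) := by
  intro f g h hf hg hh H
  rw [← lintegral_indicator hCm, ← lintegral_indicator hCm, ← lintegral_indicator hCm]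
  refine hμ _ _ _ (hf.indicator hCm) (hg.indicator hCm) (hh.indicator hCm) ?_
  intro x y
  by_cases hx : x ∈ C
  · by_cases hy : y ∈ C
    · have hxy : (1 / 2 : ℝ) • (x + y) ∈ C := by
        rw [smul_add]
        exact hC hx hy (by norm_num) (by norm_num) (by norm_num)
      rw [Set.indicator_of_mem hx, Set.indicator_of_mem hy, Set.indicator_of_mem hxy]
      exact H x y
    · simp [hy]
  · simp [hx]

theorem pi {s : ℕ} {μ : Measure E} [SigmaFinite μ] (hμ : MidpointPrekopaLeindler μ) :
    MidpointPrekopaLeindler (Measure.pi fun _ : Fin s => μ) := by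
  induction s with
  | zero =>
    intro f g h hf hg hh H
    rw [Measure.pi_of_empty _ 0, lintegral_dirac' _ hf, lintegral_dirac' _ hg,
      lintegral_dirac' _ hh]
    convert H 0 0
  | succ s ih =>
    refine (hμ.prod ih).of_measurePreserving
      (measurePreserving_piFinSuccAbove (fun _ : Fin (s + 1) => μ) 0).symm ?_
    rintro ⟨x, u⟩ ⟨y, v⟩
    ext1 i
    refine Fin.cases ?_ (fun j => ?_) i <;> simp [MeasurableEquiv.piFinSuccAbove, Fin.insertNthEquiv]

end MidpointPrekopaLeindler

/-! ### Prékopa–Leindler on the line and on Euclidean space. -/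

/-- With `a = max A` and `b = min B`, the translates `A + b` and `a + B` lie in `Z` and meet only at
`a + b`. -/
theorem volume_add_le_of_isCompact {A B Z : Set ℝ} (hA : IsCompact A) (hB : IsCompact B)
    (hA0 : A.Nonempty) (hB0 : B.Nonempty) (hZ : ∀ a ∈ A, ∀ b ∈ B, a + b ∈ Z) :
    volume A + volume B ≤ volume Z := by
  obtain ⟨a, ha, hmax⟩ := hA.exists_isGreatest hA0
  obtain ⟨b, hb, hmin⟩ := hB.exists_isLeast hB0
  have h1 : volume ((fun x => x + b) '' A) = volume A := by
    simp
  have h2 : volume ((fun x => a + x) '' B) = volume B := by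
    simp
  have hm : MeasurableSet ((fun x => a + x) '' B) :=
    (hB.image (by fun_prop)).measurableSet
  have hd : AEDisjoint volume ((fun x => x + b) '' A) ((fun x => a + x) '' B) := by
    refine measure_mono_null (t := {a + b}) ?_ (by simp)
    rintro _ ⟨⟨x, hx, rfl⟩, ⟨y, hy, hxy⟩⟩
    have h1 := hmax hx
    have h2 := hmin hy
    simp only at hxy
    simp only [Set.mem_singleton_iff]
    linarith
  rw [← h1, ← h2, ← measure_union₀ hm.nullMeasurableSet hd]
  refine measure_mono ?_
  rintro _ (⟨x, hx, rfl⟩ | ⟨y, hy, rfl⟩)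
  · exact hZ _ hx _ hb
  · exact hZ _ ha _ hy

theorem volume_add_le {A B Z : Set ℝ} (hA : MeasurableSet A) (hB : MeasurableSet B)
    (hA0 : A.Nonempty) (hB0 : B.Nonempty) (hZ : ∀ a ∈ A, ∀ b ∈ B, a + b ∈ Z) :
    volume A + volume B ≤ volume Z := by
  obtain ⟨a, ha⟩ := hA0
  obtain ⟨b, hb⟩ := hB0
  rw [hA.measure_eq_iSup_isCompact, hB.measure_eq_iSup_isCompact]
  simp only [iSup_and']
  refine ENNReal.biSup_add_biSup_le' ⟨∅, by simp⟩ ⟨∅, by simp⟩ fun K hK L hL => ?_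
  -- The compact subsets from inner regularity may be empty; adding one point makes the compact case
  -- applicable.
  calc volume K + volume L ≤ volume (insert a K) + volume (insert b L) := by
        gcongr <;> exact Set.subset_insert _ _
    _ ≤ volume Z := by
        refine volume_add_le_of_isCompact (hK.2.insert a) (hL.2.insert b)
          (Set.insert_nonempty _ _) (Set.insert_nonempty _ _) fun x hx y hy => hZ _ ?_ _ ?_
        · exact Set.insert_subset ha hK.1 hx
        · exact Set.insert_subset hb hL.1 hy

/-- Layer cake: as `f` and `g` both have supremum `1`, their superlevel sets are non-empty for the
same `t < 1`. Half their sum lies in `{h > t}` because `h² ≥ f g > t²`, so the one-dimensional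
Brunn–Minkowski inequality applies at each level. -/
theorem lintegral_add_le_two_mul_of_midpoint {f g h : ℝ → ℝ} (hf : Measurable f)
    (hg : Measurable g) (hh : Measurable h) (hf0 : ∀ x, 0 ≤ f x) (hg0 : ∀ x, 0 ≤ g x)
    (hh0 : ∀ x, 0 ≤ h x) (hf1 : ∀ x, f x ≤ 1) (hg1 : ∀ x, g x ≤ 1)
    (hfs : ∀ t < 1, ∃ x, t < f x) (hgs : ∀ t < 1, ∃ x, t < g x)
    (H : ∀ x y, f x * g y ≤ h ((1 / 2 : ℝ) * (x + y)) ^ 2) :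
    (∫⁻ x, ENNReal.ofReal (f x)) + ∫⁻ x, ENNReal.ofReal (g x) ≤
      2 * ∫⁻ x, ENNReal.ofReal (h x) := by
  rw [lintegral_eq_lintegral_meas_lt _ (.of_forall hf0) hf.aemeasurable,
    lintegral_eq_lintegral_meas_lt _ (.of_forall hg0) hg.aemeasurable,
    lintegral_eq_lintegral_meas_lt _ (.of_forall hh0) hh.aemeasurable,
    ← lintegral_const_mul' _ _ (by simp)]
  have hm : Measurable fun t : ℝ => volume {a | t < f a} :=
    Antitone.measurable fun s t hst => measure_mono fun x hx => lt_of_le_of_lt hst hx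
  rw [← lintegral_add_left hm]
  refine setLIntegral_mono' measurableSet_Ioi fun t (ht : 0 < t) => ?_
  by_cases ht1 : t < 1
  · have hscale : volume {x | t < h ((1 / 2 : ℝ) * x)} = 2 * volume {x | t < h x} := by
      have := Real.volume_preimage_mul_left (a := 1 / 2) (by norm_num) {x | t < h x}
      rw [Set.preimage_ofPred_eq] at this
      rw [this]
      congr 1
      norm_num
    rw [← hscale]
    refine volume_add_le (measurableSet_lt measurable_const hf)
      (measurableSet_lt measurable_const hg) (hfs t ht1) (hgs t ht1) fun a ha b hb => ?_
    have ha' : t < f a := ha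
    have hb' : t < g b := hb
    refine lt_of_pow_lt_pow_left₀ 2 (hh0 _) (lt_of_lt_of_le ?_ (H a b))
    nlinarith
  · have h1 : {a | t < f a} = ∅ := by
      ext x
      simpa using (hf1 x).trans (not_lt.1 ht1)
    have h2 : {a | t < g a} = ∅ := by
      ext x
      simpa using (hg1 x).trans (not_lt.1 ht1)
    simp [h1, h2]

theorem ENNReal.four_mul_le_sq_add (x y : ENNReal) : 4 * (x * y) ≤ (x + y) ^ 2 := by
  rcases eq_or_ne x ⊤ with rfl | hx
  · simp
  rcases eq_or_ne y ⊤ with rfl | hy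
  · simp
  lift x to NNReal using hx
  lift y to NNReal using hy
  norm_cast
  rw [← NNReal.coe_le_coe]
  push_cast
  nlinarith [sq_nonneg ((x : ℝ) - y)]

/-- Normalizing `f`, `g` by their suprema `a`, `b` and `h` by `√(ab)` reduces to the additive
inequality; AM–GM then gives the product form. -/
theorem lintegral_mul_le_sq_of_midpoint_of_bounded {f g h : ℝ → ENNReal} (hf : Measurable f)
    (hg : Measurable g) (hh : Measurable h) (hfb : ⨆ x, f x ≠ ⊤) (hgb : ⨆ x, g x ≠ ⊤)
    (hf0 : ⨆ x, f x ≠ 0) (hg0 : ⨆ x, g x ≠ 0)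
    (H : ∀ x y, f x * g y ≤ h ((1 / 2 : ℝ) * (x + y)) ^ 2) :
    (∫⁻ x, f x) * ∫⁻ x, g x ≤ (∫⁻ x, h x) ^ 2 := by
  set a := (⨆ x, f x).toReal with ha
  set b := (⨆ x, g x).toReal with hb
  have ha0 : 0 < a := ENNReal.toReal_pos hf0 hfb
  have hb0 : 0 < b := ENNReal.toReal_pos hg0 hgb
  have haa : ENNReal.ofReal a = ⨆ x, f x := ENNReal.ofReal_toReal hfb
  have hbb : ENNReal.ofReal b = ⨆ x, g x := ENNReal.ofReal_toReal hgb
  have hfa : ∀ x, f x ≤ ENNReal.ofReal a := fun x => haa ▸ le_iSup f x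
  have hga : ∀ x, g x ≤ ENNReal.ofReal b := fun x => hbb ▸ le_iSup g x
  have hft : ∀ x, f x ≠ ⊤ := fun x => ne_top_of_le_ne_top ENNReal.ofReal_ne_top (hfa x)
  have hgt : ∀ x, g x ≠ ⊤ := fun x => ne_top_of_le_ne_top ENNReal.ofReal_ne_top (hga x)
  set c := Real.sqrt (a * b) with hc
  have hc0 : 0 < c := Real.sqrt_pos.2 (mul_pos ha0 hb0)
  have hcc : c ^ 2 = a * b := Real.sq_sqrt (mul_pos ha0 hb0).le
  -- Truncation at `c = √(ab)` makes `h` finite, and the midpoint hypothesis survives since `f g ≤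
  -- ab = c²`.
  set k : ℝ → ENNReal := fun x => min (h x) (ENNReal.ofReal c) with hk
  have hkt : ∀ x, k x ≠ ⊤ := fun x =>
    ne_top_of_le_ne_top ENNReal.ofReal_ne_top (min_le_right _ _)
  have hkm : Measurable k := hh.min measurable_const
  have Hk : ∀ x y, f x * g y ≤ k ((1 / 2 : ℝ) * (x + y)) ^ 2 := by
    intro x y
    rcases min_choice (h ((1 / 2 : ℝ) * (x + y))) (ENNReal.ofReal c) with h1 | h1
    · simp only [hk, h1]
      exact H x y
    · simp only [hk, h1]
      rw [← ENNReal.ofReal_pow hc0.le, hcc, ENNReal.ofReal_mul ha0.le]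
      gcongr
      exacts [hfa x, hga y]
  have hfe : ∫⁻ x, f x = ENNReal.ofReal a * ∫⁻ x, ENNReal.ofReal ((f x).toReal / a) := by
    rw [← lintegral_const_mul' _ _ ENNReal.ofReal_ne_top]
    refine lintegral_congr fun x => ?_
    rw [← ENNReal.ofReal_mul ha0.le, mul_div_cancel₀ _ ha0.ne', ENNReal.ofReal_toReal (hft x)]
  have hge : ∫⁻ x, g x = ENNReal.ofReal b * ∫⁻ x, ENNReal.ofReal ((g x).toReal / b) := by
    rw [← lintegral_const_mul' _ _ ENNReal.ofReal_ne_top]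
    refine lintegral_congr fun x => ?_
    rw [← ENNReal.ofReal_mul hb0.le, mul_div_cancel₀ _ hb0.ne', ENNReal.ofReal_toReal (hgt x)]
  have hke : ∫⁻ x, k x = ENNReal.ofReal c * ∫⁻ x, ENNReal.ofReal ((k x).toReal / c) := by
    rw [← lintegral_const_mul' _ _ ENNReal.ofReal_ne_top]
    refine lintegral_congr fun x => ?_
    rw [← ENNReal.ofReal_mul hc0.le, mul_div_cancel₀ _ hc0.ne', ENNReal.ofReal_toReal (hkt x)]
  have key := lintegral_add_le_two_mul_of_midpoint (f := fun x => (f x).toReal / a)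
    (g := fun x => (g x).toReal / b) (h := fun x => (k x).toReal / c)
    (hf.ennreal_toReal.div_const a) (hg.ennreal_toReal.div_const b) (hkm.ennreal_toReal.div_const c)
    (fun x => by positivity) (fun x => by positivity) (fun x => by positivity)
    (fun x => by
      rw [div_le_one ha0]
      exact ENNReal.toReal_mono hfb (le_iSup f x))
    (fun x => by
      rw [div_le_one hb0]
      exact ENNReal.toReal_mono hgb (le_iSup g x))
    (fun t ht => by
      have h1 : ENNReal.ofReal (t * a) < ⨆ x, f x := by
        rw [← haa, ENNReal.ofReal_lt_ofReal_iff ha0]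
        nlinarith
      obtain ⟨x, hx⟩ := lt_iSup_iff.1 h1
      exact ⟨x, by 
        rw [← ENNReal.ofReal_toReal (hft x), ENNReal.ofReal_lt_ofReal_iff'] at hx
        exact (lt_div_iff₀ ha0).2 hx.1⟩)
    (fun t ht => by
      have h1 : ENNReal.ofReal (t * b) < ⨆ x, g x := by
        rw [← hbb, ENNReal.ofReal_lt_ofReal_iff hb0]
        nlinarith
      obtain ⟨x, hx⟩ := lt_iSup_iff.1 h1
      exact ⟨x, by 
        rw [← ENNReal.ofReal_toReal (hgt x), ENNReal.ofReal_lt_ofReal_iff'] at hx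
        exact (lt_div_iff₀ hb0).2 hx.1⟩)
    (fun x y => by
      rw [div_mul_div_comm, div_pow, hcc, ← ENNReal.toReal_mul, ← ENNReal.toReal_pow]
      gcongr
      · exact ENNReal.pow_ne_top (hkt _)
      · exact Hk x y)
  set X := ∫⁻ x, ENNReal.ofReal ((f x).toReal / a)
  set Y := ∫⁻ x, ENNReal.ofReal ((g x).toReal / b)
  set Z := ∫⁻ x, ENNReal.ofReal ((k x).toReal / c)
  have h4 : 4 * (X * Y) ≤ 4 * Z ^ 2 := by
    calc 4 * (X * Y) ≤ (X + Y) ^ 2 := ENNReal.four_mul_le_sq_add X Y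
      _ ≤ (2 * Z) ^ 2 := by gcongr
      _ = 4 * Z ^ 2 := by ring
  have h5 : X * Y ≤ Z ^ 2 := (ENNReal.mul_le_mul_iff_right (by simp) (by simp)).1 h4
  calc (∫⁻ x, f x) * ∫⁻ x, g x = ENNReal.ofReal (c ^ 2) * (X * Y) := by
        rw [hfe, hge, hcc, ENNReal.ofReal_mul ha0.le]
        ring
    _ ≤ ENNReal.ofReal (c ^ 2) * Z ^ 2 := by gcongr
    _ = (∫⁻ x, k x) ^ 2 := by
        rw [hke, ENNReal.ofReal_pow hc0.le]
        ring
    _ ≤ (∫⁻ x, h x) ^ 2 := by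
        gcongr with x
        exact min_le_left _ _

theorem lintegral_eq_iSup_min_natCast {α : Type*} [MeasurableSpace α] {μ : Measure α}
    {f : α → ENNReal} (hf : Measurable f) :
    ∫⁻ x, f x ∂μ = ⨆ n : ℕ, ∫⁻ x, min (f x) n ∂μ := by
  rw [← lintegral_iSup (fun n => hf.min measurable_const)
    (fun m n hmn x => min_le_min_left _ (by exact_mod_cast hmn))]
  refine lintegral_congr fun x => ?_
  rw [← inf_iSup_eq, ENNReal.iSup_natCast, inf_top_eq]

theorem midpointPrekopaLeindler_real : MidpointPrekopaLeindler (volume : Measure ℝ) := by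
  intro f g h hf hg hh H
  rw [lintegral_eq_iSup_min_natCast hf, lintegral_eq_iSup_min_natCast hg, ENNReal.iSup_mul]
  refine iSup_le fun m => ?_
  rw [ENNReal.mul_iSup]
  refine iSup_le fun n => ?_
  by_cases h1 : ⨆ x, min (f x) m = 0
  · simp only [ENNReal.iSup_eq_zero] at h1
    simp [h1]
  by_cases h2 : ⨆ x, min (g x) n = 0
  · simp only [ENNReal.iSup_eq_zero] at h2
    simp [h2]
  refine lintegral_mul_le_sq_of_midpoint_of_bounded (hf.min measurable_const)
    (hg.min measurable_const) hh ?_ ?_ h1 h2 fun x y => ?_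
  · exact ne_top_of_le_ne_top (ENNReal.natCast_ne_top m) (iSup_le fun x => min_le_right _ _)
  · exact ne_top_of_le_ne_top (ENNReal.natCast_ne_top n) (iSup_le fun x => min_le_right _ _)
  · refine le_trans ?_ (H x y)
    gcongr <;> exact min_le_left _ _

theorem midpointPrekopaLeindler_euclideanSpace (n : ℕ) :
    MidpointPrekopaLeindler (volume : Measure (EuclideanSpace ℝ (Fin n))) :=
  (midpointPrekopaLeindler_real.pi (s := n)).of_measurePreserving
    (PiLp.volume_preserving_toLp (Fin n)) fun _ _ => rfl

/-! ### Borell's lemma and reverse Hölder for seminorms. -/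

/-- Borell's lemma, for the dilation factor `3`. -/
theorem MidpointPrekopaLeindler.borell {E : Type*} [AddCommGroup E] [Module ℝ E]
    [MeasurableSpace E] {μ : Measure E} (hμ : MidpointPrekopaLeindler μ) (p : Seminorm ℝ E)
    (hp : Measurable p) (a : ℝ) :
    μ {x | p x ≤ a} * μ {x | 3 * a < p x} ≤ μ {x | a < p x} ^ 2 := by
  have h1 : MeasurableSet {x | p x ≤ a} := measurableSet_le hp measurable_const
  have h2 : MeasurableSet {x | 3 * a < p x} := measurableSet_lt measurable_const hp
  have h3 : MeasurableSet {x | a < p x} := measurableSet_lt measurable_const hp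
  rw [← lintegral_indicator_one h1, ← lintegral_indicator_one h2, ← lintegral_indicator_one h3]
  refine hμ _ _ _ (measurable_one.indicator h1) (measurable_one.indicator h2)
    (measurable_one.indicator h3) fun x y => ?_
  by_cases hx : p x ≤ a
  · by_cases hy : 3 * a < p y
    -- The midpoint of a point with `p ≤ a` and one with `p > 3a` has `p > (3a - a)/2 = a`.
    · have hz : a < p ((1 / 2 : ℝ) • (x + y)) := by
        rw [map_smul_eq_mul]
        have h4 : p y ≤ p (x + y) + p x := by
          simpa using map_sub_le_add p (x + y) x
        norm_num
        linarith
      simp only [Set.indicator, Set.mem_ofPred_eq, hx, hy, hz, if_true]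
      simp
    · simp [Set.indicator, hy]
  · simp [Set.indicator, hx]

theorem MidpointPrekopaLeindler.measure_three_mul_lt_le {E : Type*} [AddCommGroup E] [Module ℝ E]
    [MeasurableSpace E] {μ : Measure E} [IsProbabilityMeasure μ] (hμ : MidpointPrekopaLeindler μ)
    (p : Seminorm ℝ E) (hp : Measurable p) {a : ℝ} (ha : μ.real {x | a < p x} ≤ 1 / 20) :
    μ {x | 3 * a < p x} ≤ ENNReal.ofReal (1 / 19) * μ {x | a < p x} := by
  have h := ENNReal.toReal_mono (by finiteness) (hμ.borell p hp a)
  rw [ENNReal.toReal_mul, ENNReal.toReal_pow] at h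
  change μ.real _ * μ.real _ ≤ μ.real _ ^ 2 at h
  have hc : μ.real {x | p x ≤ a} = 1 - μ.real {x | a < p x} := by
    rw [← probReal_compl_eq_one_sub (measurableSet_lt measurable_const hp)]
    congr 1
    ext x
    simp
  rw [hc] at h
  have h0 : 0 ≤ μ.real {x | a < p x} := measureReal_nonneg
  have h1 : 0 ≤ μ.real {x | 3 * a < p x} := measureReal_nonneg
  -- With `q` the tail at `a`, Borell bounds the tail at `3a` by `q²/(1 - q)`, and `q ≤ 1/20` gives
  -- `q/19`.
  have h2 : μ.real {x | 3 * a < p x} ≤ 1 / 19 * μ.real {x | a < p x} := by nlinarith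
  rw [← ofReal_measureReal (μ := μ) (s := {x | 3 * a < p x}),
    ← ofReal_measureReal (μ := μ) (s := {x | a < p x}), ← ENNReal.ofReal_mul (by norm_num)]
  exact ENNReal.ofReal_le_ofReal h2

/-- The reverse Hölder inequality for seminorms: the second moment of a seminorm with respect to a
log-concave probability measure is controlled by its first moment. -/
theorem MidpointPrekopaLeindler.integral_sq_le {E : Type*} [AddCommGroup E] [Module ℝ E]
    [MeasurableSpace E] {μ : Measure E} [IsProbabilityMeasure μ] (hμ : MidpointPrekopaLeindler μ)
    (p : Seminorm ℝ E) (hp : Measurable p) (hp1 : Integrable p μ)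
    (hp2 : Integrable (fun x => p x ^ 2) μ) :
    ∫ x, p x ^ 2 ∂μ ≤ 7200 * (∫ x, p x ∂μ) ^ 2 := by
  set m := ∫ x, p x ∂μ with hm
  have hm0 : 0 ≤ m := integral_nonneg fun x => apply_nonneg p x
  rcases hm0.eq_or_lt with h0 | hmpos
  · have h1 : (p : E → ℝ) =ᵐ[μ] 0 :=
      (integral_eq_zero_iff_of_nonneg (fun x => apply_nonneg p x) hp1).1 h0.symm
    have h2 : ∫ x, p x ^ 2 ∂μ = ∫ x, (0 : ℝ) ∂μ := by
      refine integral_congr_ae ?_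
      filter_upwards [h1] with x hx
      simp [hx]
    rw [h2]
    simp
    positivity
  -- By Markov's inequality the tail beyond `20m` is at most `1/20`, the threshold for the tail
  -- decay.
  set a := 20 * m with ha
  have ha0 : 0 ≤ a := by positivity
  have hq : ∀ t, a ≤ t → μ.real {x | t < p x} ≤ 1 / 20 := by
    intro t hat
    have h1 := mul_meas_ge_le_integral_of_nonneg (.of_forall fun x => apply_nonneg p x) hp1 a
    have h2 : μ.real {x | t < p x} ≤ μ.real {x | a ≤ p x} :=
      measureReal_mono fun x hx => hat.trans (le_of_lt hx)
    have h3 : μ.real {x | a ≤ p x} * m ≤ 1 / 20 * m := by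
      rw [← hm] at h1
      nlinarith
    exact h2.trans (le_of_mul_le_mul_right h3 hmpos)
  have hpt : ∀ t, μ {x | t < p x / 3} ≤
      μ {_x : E | t < a} + ENNReal.ofReal (1 / 19) * μ {x | t < p x} := by
    intro t
    have h1 : {x | t < p x / 3} = {x | 3 * t < p x} := by
      ext x
      rw [Set.mem_ofPred_eq, Set.mem_ofPred_eq, lt_div_iff₀ (by norm_num), mul_comm]
    rw [h1]
    by_cases h : t < a
    · simpa [h] using prob_le_one.trans le_self_add
    · exact (hμ.measure_three_mul_lt_le p hp (hq t (not_lt.1 h))).trans le_add_self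
  have hmeas : ∀ f : E → ℝ, Measurable fun t : ℝ => μ {x | t < f x} := fun f =>
    Antitone.measurable fun s t hst => measure_mono fun x hx => lt_of_le_of_lt hst hx
  -- The pointwise tail bound integrated against `2t dt`. Since `1/19 < 1/9`, the last term is
  -- absorbed on the left: `(1/9 - 1/19) ∫ p² ≤ 400 m²`, so `∫ p² ≤ 6840 m²`.
  have key : ∫⁻ x, ENNReal.ofReal ((p x / 3) ^ (2 : ℝ)) ∂μ ≤
      ∫⁻ _x : E, ENNReal.ofReal (a ^ (2 : ℝ)) ∂μ +
        ENNReal.ofReal (1 / 19) * ∫⁻ x, ENNReal.ofReal (p x ^ (2 : ℝ)) ∂μ := by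
    rw [lintegral_rpow_eq_lintegral_meas_lt_mul μ
        (.of_forall fun x => div_nonneg (apply_nonneg p x) (by norm_num))
        (hp.div_const 3).aemeasurable two_pos,
      lintegral_rpow_eq_lintegral_meas_lt_mul μ (.of_forall fun _ => ha0)
        aemeasurable_const two_pos,
      lintegral_rpow_eq_lintegral_meas_lt_mul μ (.of_forall fun x => apply_nonneg p x)
        hp.aemeasurable two_pos, mul_left_comm, ← mul_add,
      ← lintegral_const_mul' (ENNReal.ofReal (1 / 19)) _ ENNReal.ofReal_ne_top,
      ← lintegral_add_left]
    · gcongr with t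
      rw [← mul_assoc, ← add_mul]
      gcongr
      exact hpt t
    · exact (hmeas _).mul (by fun_prop)
  simp only [Real.rpow_two, div_pow] at key
  rw [← ofReal_integral_eq_lintegral_ofReal (hp2.div_const _)
      (.of_forall fun x => by positivity),
    ← ofReal_integral_eq_lintegral_ofReal hp2 (.of_forall fun x => by positivity),
    lintegral_const, measure_univ, mul_one, ← ENNReal.ofReal_mul (by norm_num),
    ← ENNReal.ofReal_add (by positivity) (mul_nonneg (by norm_num)
      (integral_nonneg fun x => by positivity)), ENNReal.ofReal_le_ofReal_iff
      (add_nonneg (by positivity) (mul_nonneg (by norm_num)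
      (integral_nonneg fun x => by positivity))), integral_div, ha] at key
  nlinarith

/-! ### The norm defined by a symmetric convex body. -/

namespace IsSymmConvexBody

variable {n : ℕ} {K : Set (EuclideanSpace ℝ (Fin n))}

theorem neg_mem (hK : IsSymmConvexBody K) : ∀ x ∈ K, -x ∈ K := fun x hx => by
  rw [← Set.mem_neg, hK.neg_eq]
  exact hx

theorem mem_nhds_zero (hK : IsSymmConvexBody K) : K ∈ nhds 0 := by
  obtain ⟨x, hx⟩ := hK.interior_nonempty
  have hneg : -x ∈ interior K := by
    have h := (Homeomorph.neg (EuclideanSpace ℝ (Fin n))).preimage_interior K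
    have hKn : Homeomorph.neg (EuclideanSpace ℝ (Fin n)) ⁻¹' K = K := hK.neg_eq
    rw [hKn] at h
    rw [← h] at hx
    exact hx
  have h := hK.convex.interior hx hneg (a := 1 / 2) (b := 1 / 2)
    (by norm_num) (by norm_num) (by norm_num)
  rw [smul_neg, add_neg_cancel] at h
  exact mem_interior_iff_mem_nhds.1 h

theorem absorbent (hK : IsSymmConvexBody K) : Absorbent ℝ K := absorbent_nhds_zero hK.mem_nhds_zero

theorem balanced (hK : IsSymmConvexBody K) : Balanced ℝ K :=
  (balanced_iff_neg_mem hK.convex).2 fun {x} hx => hK.neg_mem x hx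

/-- The norm with unit ball `K`, as a seminorm. -/
noncomputable def seminorm (hK : IsSymmConvexBody K) : Seminorm ℝ (EuclideanSpace ℝ (Fin n)) :=
  gaugeSeminorm hK.balanced hK.convex hK.absorbent

theorem seminorm_apply (hK : IsSymmConvexBody K) (x : EuclideanSpace ℝ (Fin n)) :
    hK.seminorm x = gauge K x := rfl

theorem continuous_gauge (hK : IsSymmConvexBody K) : Continuous (gauge K) :=
  _root_.continuous_gauge hK.convex hK.mem_nhds_zero

theorem gauge_smul (hK : IsSymmConvexBody K) (r : ℝ) (x : EuclideanSpace ℝ (Fin n)) :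
    gauge K (r • x) = |r| * gauge K x := _root_.gauge_smul hK.balanced r x

theorem exists_gauge_le_mul_norm (hK : IsSymmConvexBody K) :
    ∃ b : ℝ, 0 ≤ b ∧ ∀ x, gauge K x ≤ b * ‖x‖ := by
  obtain ⟨r, hr, h⟩ := Metric.mem_nhds_iff.1 hK.mem_nhds_zero
  refine ⟨r⁻¹, by positivity, fun x => ?_⟩
  rw [inv_mul_eq_div, le_div_iff₀ hr, mul_comm]
  exact mul_gauge_le_norm h

theorem exists_norm_le_mul_gauge (hK : IsSymmConvexBody K) :
    ∃ a : ℝ, 0 ≤ a ∧ ∀ x, ‖x‖ ≤ a * gauge K x := by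
  obtain ⟨r, hr, h⟩ := hK.isCompact.isBounded.subset_closedBall_lt 0 0
  refine ⟨r, hr.le, fun x => ?_⟩
  have := le_gauge_of_subset_closedBall hK.absorbent hr.le h (x := x)
  rwa [div_le_iff₀ hr, mul_comm] at this

end IsSymmConvexBody

/-! ### Rademacher averages and the type-2 constant. -/

/-- Flipping the `i`-th sign permutes the sign vectors and negates every summand. -/
theorem sum_units_int_mul_eq_zero {k : ℕ} {i j : Fin k} (hij : i ≠ j) :
    ∑ ε : Fin k → ℤˣ, ((ε i : ℤ) : ℝ) * ((ε j : ℤ) : ℝ) = 0 := by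
  have h := Equiv.sum_comp (Equiv.mulLeft (Pi.mulSingle i (-1 : ℤˣ)))
    fun ε : Fin k → ℤˣ => ((ε i : ℤ) : ℝ) * ((ε j : ℤ) : ℝ)
  simp only [Equiv.coe_mulLeft, Pi.mul_apply, Pi.mulSingle_eq_same,
    Pi.mulSingle_eq_of_ne hij.symm, one_mul, Units.val_neg, Int.cast_neg, neg_mul, Finset.sum_neg_distrib] at h
  linarith

/-- Orthogonality of the Rademacher functions. -/
theorem sum_units_norm_sq {E : Type*} [NormedAddCommGroup E] [InnerProductSpace ℝ E] {k : ℕ}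
    (v : Fin k → E) :
    ∑ ε : Fin k → ℤˣ, ‖∑ i, ((ε i : ℤ) : ℝ) • v i‖ ^ 2 = 2 ^ k * ∑ i, ‖v i‖ ^ 2 := by
  simp only [← real_inner_self_eq_norm_sq, sum_inner, inner_sum, real_inner_smul_left,
    real_inner_smul_right]
  rw [Finset.sum_comm, Finset.mul_sum]
  refine Finset.sum_congr rfl fun i _ => ?_
  rw [Finset.sum_comm, Finset.sum_eq_single i]
  · have h1 : ∀ u : ℤˣ, ((u : ℤ) : ℝ) * ((u : ℤ) : ℝ) = 1 := fun u => by
      rw [← Int.cast_mul, ← Units.val_mul, Int.units_mul_self]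
      simp
    simp only [← mul_assoc, h1]
    simp [Fintype.card_units_int]
  · intro j _ hj
    simp only [← mul_assoc]
    rw [← Finset.sum_mul, sum_units_int_mul_eq_zero hj.symm, zero_mul]
  · simp

section TypeTwo

variable {n : ℕ} {K : Set (EuclideanSpace ℝ (Fin n))}

/-- Equivalence with the Euclidean norm, for which type 2 is an identity with constant `1`. The
bound is uniform in `k`, so the infimum and supremum defining `typeTwoConst` are genuine and not
default values. -/
theorem IsSymmConvexBody.exists_typeTwo_bound (hK : IsSymmConvexBody K) :
    ∃ B : ℝ, 0 ≤ B ∧ ∀ (k : ℕ) (x : Fin k → EuclideanSpace ℝ (Fin n)),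
      Real.sqrt (rademacherSq K x) ≤ B * Real.sqrt (∑ i, gauge K (x i) ^ 2) := by
  obtain ⟨a, ha0, ha⟩ := hK.exists_norm_le_mul_gauge
  obtain ⟨b, hb0, hb⟩ := hK.exists_gauge_le_mul_norm
  refine ⟨b * a, by positivity, fun k x => ?_⟩
  refine Real.sqrt_le_iff.2 ⟨by positivity, ?_⟩
  rw [mul_pow, Real.sq_sqrt (by positivity), rademacherSq, div_le_iff₀ (by positivity)]
  calc ∑ ε : Fin k → ℤˣ, gauge K (∑ i, ((ε i : ℤ) : ℝ) • x i) ^ 2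
      ≤ ∑ ε : Fin k → ℤˣ, (b * ‖∑ i, ((ε i : ℤ) : ℝ) • x i‖) ^ 2 := by
        gcongr
        · exact gauge_nonneg _
        · exact hb _
    _ = b ^ 2 * (2 ^ k * ∑ i, ‖x i‖ ^ 2) := by
        simp only [mul_pow]
        rw [← Finset.mul_sum, sum_units_norm_sq]
    _ ≤ b ^ 2 * (2 ^ k * ∑ i, (a * gauge K (x i)) ^ 2) := by
        gcongr
        exact ha _
    _ = (b * a) ^ 2 * (∑ i, gauge K (x i) ^ 2) * 2 ^ k := by
        simp only [mul_pow]
        rw [← Finset.mul_sum]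
        ring

theorem typeTwoConstOn_nonneg (k : ℕ) : 0 ≤ typeTwoConstOn K k :=
  Real.sInf_nonneg fun _ hT => hT.1

theorem typeTwoConst_nonneg : 0 ≤ typeTwoConst K :=
  Real.iSup_nonneg fun k => typeTwoConstOn_nonneg k

theorem IsSymmConvexBody.rademacherSq_le (hK : IsSymmConvexBody K) {k : ℕ}
    (x : Fin k → EuclideanSpace ℝ (Fin n)) :
    rademacherSq K x ≤ typeTwoConst K ^ 2 * ∑ i, gauge K (x i) ^ 2 := by
  obtain ⟨B, hB0, hB⟩ := hK.exists_typeTwo_bound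
  have hbdd : BddAbove (Set.range fun k => typeTwoConstOn K k) := by
    refine ⟨B, ?_⟩
    rintro _ ⟨k, rfl⟩
    exact csInf_le ⟨0, fun T hT => hT.1⟩ ⟨hB0, hB k⟩
  have hle : Real.sqrt (rademacherSq K x) ≤
      typeTwoConstOn K k * Real.sqrt (∑ i, gauge K (x i) ^ 2) := by
    -- Passing to the infimum over `T` needs division by the right-hand factor; if that factor is
    -- zero, the crude bound already settles the claim.
    rcases (Real.sqrt_nonneg (∑ i, gauge K (x i) ^ 2)).eq_or_lt with h0 | hpos
    · have := hB k x
      rw [← h0] at this ⊢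
      simpa using this
    · rw [← div_le_iff₀ hpos]
      refine le_csInf ⟨B, hB0, hB k⟩ fun T hT => ?_
      rw [div_le_iff₀ hpos]
      exact hT.2 x
  have h2 : Real.sqrt (rademacherSq K x) ≤
      typeTwoConst K * Real.sqrt (∑ i, gauge K (x i) ^ 2) :=
    hle.trans (mul_le_mul_of_nonneg_right (le_ciSup hbdd k) (Real.sqrt_nonneg _))
  have h3 := (Real.sqrt_le_left (mul_nonneg typeTwoConst_nonneg (Real.sqrt_nonneg _))).1 h2
  rwa [mul_pow, Real.sq_sqrt (Finset.sum_nonneg fun i _ => sq_nonneg _)] at h3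

end TypeTwo

/-! ### Insertion of random signs, for uniform vectors in a body and for Gaussian scalars alike. -/

section Symmetrization

variable {V : Type*} [AddCommGroup V] [Module ℝ V] [MeasurableSpace V]
  {μ : Measure V} [IsProbabilityMeasure μ] {s : ℕ}

theorem measurePreserving_sign_smul (hμ : MeasurePreserving (fun v : V => -v) μ μ)
    (ε : Fin s → ℤˣ) :
    MeasurePreserving (fun (v : Fin s → V) i => ((ε i : ℤ) : ℝ) • v i)
      (Measure.pi fun _ => μ) (Measure.pi fun _ => μ) := by
  refine measurePreserving_pi (fun _ => μ) (fun _ => μ) fun i => ?_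
  rcases Int.units_eq_one_or (ε i) with h | h
  · convert MeasurePreserving.id μ using 1
    ext v
    simp [h]
  · convert hμ using 1
    ext v
    simp [h]

theorem integral_pi_eq_integral_sum_signs (hμ : MeasurePreserving (fun v : V => -v) μ μ)
    {F : (Fin s → V) → ℝ} (hF : Integrable F (Measure.pi fun _ => μ)) :
    ∫ v, F v ∂(Measure.pi fun _ => μ) =
      ∫ v, (∑ ε : Fin s → ℤˣ, F fun i => ((ε i : ℤ) : ℝ) • v i) / 2 ^ s
        ∂(Measure.pi fun _ => μ) := by
  have h1 : ∀ ε : Fin s → ℤˣ, Integrable (fun v => F fun i => ((ε i : ℤ) : ℝ) • v i)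
      (Measure.pi fun _ => μ) := fun ε =>
    (measurePreserving_sign_smul hμ ε).integrable_comp_of_integrable hF
  have h2 : ∀ ε : Fin s → ℤˣ, ∫ v, (F fun i => ((ε i : ℤ) : ℝ) • v i) ∂(Measure.pi fun _ => μ) =
      ∫ v, F v ∂(Measure.pi fun _ => μ) := fun ε => by
    have hm := measurePreserving_sign_smul hμ ε
    have hF' : AEStronglyMeasurable F
        (Measure.map (fun (v : Fin s → V) i => ((ε i : ℤ) : ℝ) • v i)
          (Measure.pi fun _ => μ)) := by
      rw [hm.map_eq]
      exact hF.aestronglyMeasurable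
    rw [← integral_map hm.measurable.aemeasurable hF', hm.map_eq]
  rw [integral_div, integral_finsetSum _ fun ε _ => h1 ε]
  simp [h2, Fintype.card_units_int]

/-- The type-2 inequality for linear images of independent symmetric random vectors. -/
theorem IsSymmConvexBody.integral_gauge_sum_sq_le {n : ℕ} {K : Set (EuclideanSpace ℝ (Fin n))}
    (hK : IsSymmConvexBody K) (hμ : MeasurePreserving (fun v : V => -v) μ μ)
    (A : Fin s → V →ₗ[ℝ] EuclideanSpace ℝ (Fin n))
    (hA : ∀ i, Integrable (fun v => gauge K (A i v) ^ 2) μ)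
    (hF : Integrable (fun v : Fin s → V => gauge K (∑ i, A i (v i)) ^ 2)
      (Measure.pi fun _ => μ)) :
    ∫ v, gauge K (∑ i, A i (v i)) ^ 2 ∂(Measure.pi fun _ => μ) ≤
      typeTwoConst K ^ 2 * ∑ i, ∫ v, gauge K (A i v) ^ 2 ∂μ := by
  have hA' : ∀ i, Integrable (fun v : Fin s → V => gauge K (A i (v i)) ^ 2)
      (Measure.pi fun _ => μ) := fun i =>
    (measurePreserving_eval (fun _ => μ) i).integrable_comp_of_integrable (hA i)
  have hAi : ∀ i, ∫ v : Fin s → V, gauge K (A i (v i)) ^ 2 ∂(Measure.pi fun _ => μ) =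
      ∫ v, gauge K (A i v) ^ 2 ∂μ := fun i =>
    integral_comp_eval (μ := fun _ : Fin s => μ) (i := i) (hA i).aestronglyMeasurable
  rw [integral_pi_eq_integral_sum_signs hμ hF]
  simp only [← hAi]
  rw [← integral_finsetSum _ fun i _ => hA' i, ← integral_const_mul]
  refine integral_mono_of_nonneg (.of_forall fun v => ?_)
    ((integrable_finsetSum _ fun i _ => hA' i).const_mul _) (.of_forall fun v => ?_)
  · positivity
  · simpa [rademacherSq] using hK.rademacherSq_le fun i => A i (v i)

end Symmetrization

theorem sq_integral_le_integral_sq {Ω : Type*} [MeasurableSpace Ω] {μ : Measure Ω}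
    [IsProbabilityMeasure μ] {f : Ω → ℝ} (hf : Integrable f μ)
    (hf2 : Integrable (fun x => f x ^ 2) μ) : (∫ x, f x ∂μ) ^ 2 ≤ ∫ x, f x ^ 2 ∂μ := by
  set m := ∫ x, f x ∂μ with hm
  have h : ∫ x, (f x - m) ^ 2 ∂μ = ∫ x, f x ^ 2 ∂μ - m ^ 2 := by
    have h1 : ∀ x, (f x - m) ^ 2 = f x ^ 2 - 2 * m * f x + m ^ 2 := fun x => by ring
    simp only [h1]
    rw [integral_add (by exact hf2.sub (hf.const_mul _)) (integrable_const _),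
      integral_sub hf2 (hf.const_mul _), integral_const_mul, ← hm]
    simp
    ring
  have h0 : 0 ≤ ∫ x, (f x - m) ^ 2 ∂μ := integral_nonneg fun x => sq_nonneg _
  linarith

/-! ### Polar coordinates and Gaussian averages. -/

section Polar

variable {E : Type*} [NormedAddCommGroup E] [NormedSpace ℝ E] [FiniteDimensional ℝ E]
  [MeasurableSpace E] [BorelSpace E] [Nontrivial E]

/-- Integration in polar coordinates of a `2`-homogeneous function against a radial weight. -/
theorem integral_homogeneous_mul_radial (μ : Measure E) [μ.IsAddHaarMeasure] (f : E → ℝ)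
    (w : ℝ → ℝ) (hf : ∀ (r : ℝ) (x : E), f (r • x) = r ^ 2 * f x) :
    ∫ x, f x * w ‖x‖ ∂μ = (∫ ξ, f (ξ : E) ∂μ.toSphere) *
      ∫ r : Set.Ioi (0 : ℝ), (r : ℝ) ^ 2 * w r ∂.volumeIoiPow (Module.finrank ℝ E - 1) :=
  calc
    ∫ x, f x * w ‖x‖ ∂μ = ∫ x : ({(0)}ᶜ : Set E), f x.1 * w ‖x.1‖ ∂(μ.comap (↑)) := by
      rw [integral_subtype_comap (measurableSet_singleton _).compl fun x => f x * w ‖x‖,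
        restrict_compl_singleton]
    _ = ∫ x, f (x.1 : E) * ((x.2 : ℝ) ^ 2 * w x.2)
          ∂μ.toSphere.prod (.volumeIoiPow (Module.finrank ℝ E - 1)) := by
      rw [← μ.measurePreserving_homeomorphUnitSphereProd.integral_comp
        (Homeomorph.measurableEmbedding _)]
      refine integral_congr_ae (.of_forall fun x => ?_)
      have hx : ‖(x : E)‖ ≠ 0 := norm_ne_zero_iff.2 x.2
      simp only [homeomorphUnitSphereProd_apply_fst_coe, homeomorphUnitSphereProd_apply_snd_coe]
      rw [hf]
      field_simp
    _ = _ := integral_prod_mul (fun ξ : Metric.sphere (0 : E) 1 => f (ξ : E))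
      (fun r : Set.Ioi (0 : ℝ) => (r : ℝ) ^ 2 * w r)

end Polar

section Gaussian

open ProbabilityTheory

/-- The characteristic functions agree. The value of the normalizing constant is irrelevant, as it
cancels later. -/
theorem stdGaussian_eq_withDensity (E : Type*) [NormedAddCommGroup E] [InnerProductSpace ℝ E]
    [FiniteDimensional ℝ E] [MeasurableSpace E] [BorelSpace E] :
    ∃ c : ℝ, 0 < c ∧ stdGaussian E =
      volume.withDensity fun x : E => ENNReal.ofReal (c * Real.exp (-(1 / 2) * ‖x‖ ^ 2)) := by
  have hZ := GaussianFourier.integral_rexp_neg_mul_sq_norm (V := E) (b := 1 / 2) (by norm_num)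
  set Z := ∫ v : E, Real.exp (-(1 / 2) * ‖v‖ ^ 2) with hZdef
  have hZ0 : 0 < Z := by
    rw [hZ]
    positivity
  have hint : Integrable fun v : E => Real.exp (-(1 / 2) * ‖v‖ ^ 2) := by
    by_contra h
    rw [hZdef, integral_undef h] at hZ0
    exact lt_irrefl _ hZ0
  have hZc : ((Z : ℝ) : ℂ) = (Real.pi / (1 / 2 : ℂ)) ^ (Module.finrank ℝ E / 2 : ℂ) := by
    rw [← GaussianFourier.integral_cexp_neg_mul_sq_norm (V := E) (b := 1 / 2) (by norm_num), hZdef,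
      ← integral_complex_ofReal]
    refine integral_congr_ae (.of_forall fun v => ?_)
    simp
  have hpos : ∀ x : E, 0 ≤ Z⁻¹ * Real.exp (-(1 / 2) * ‖x‖ ^ 2) := fun x => by positivity
  refine ⟨Z⁻¹, inv_pos.2 hZ0, ?_⟩
  have hfin : IsFiniteMeasure (volume.withDensity fun x : E =>
      ENNReal.ofReal (Z⁻¹ * Real.exp (-(1 / 2) * ‖x‖ ^ 2))) :=
    isFiniteMeasure_withDensity_ofReal (hint.const_mul _).hasFiniteIntegral
  refine Measure.ext_of_charFun ?_
  ext t
  rw [charFun_stdGaussian, charFun_apply,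
    integral_withDensity_eq_integral_toReal_smul (by fun_prop) (by simp)]
  have h2 : ∀ v : E, (ENNReal.ofReal (Z⁻¹ * Real.exp (-(1 / 2) * ‖v‖ ^ 2))).toReal •
      Complex.exp (inner ℝ v t * Complex.I) =
      (Z : ℂ)⁻¹ * Complex.exp (-(1 / 2 : ℂ) * ‖v‖ ^ 2 + Complex.I * inner ℝ t v) := fun v => by
    rw [ENNReal.toReal_ofReal (hpos v), Complex.real_smul, real_inner_comm, Complex.exp_add]
    push_cast
    ring_nf
  simp only [h2]
  rw [integral_const_mul, GaussianFourier.integral_cexp_neg_mul_sq_norm_add (by norm_num), ← hZc,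
    ← mul_assoc, inv_mul_cancel₀ (by exact_mod_cast hZ0.ne'), one_mul]
  congr 1
  rw [Complex.I_sq]
  ring

theorem integral_sq_gaussianReal : ∫ x, x ^ 2 ∂gaussianReal 0 1 = 1 := by
  have h := variance_id_gaussianReal (μ := 0) (v := 1)
  rw [variance_eq_integral aemeasurable_id] at h
  simpa using h

theorem integrable_norm_sq_stdGaussian (n : ℕ) :
    Integrable (fun x => ‖x‖ ^ 2) (stdGaussian (EuclideanSpace ℝ (Fin n))) :=
  (IsGaussian.memLp_two_id (μ := stdGaussian (EuclideanSpace ℝ (Fin n)))).integrable_norm_pow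
    two_ne_zero

theorem integrable_sq_gaussianReal : Integrable (fun x : ℝ => x ^ 2) (gaussianReal 0 1) := by
  simpa using (IsGaussian.memLp_two_id (μ := gaussianReal 0 1)).integrable_norm_pow two_ne_zero

theorem integral_norm_sq_stdGaussian (n : ℕ) :
    ∫ x, ‖x‖ ^ 2 ∂stdGaussian (EuclideanSpace ℝ (Fin n)) = n := by
  rw [← map_pi_eq_stdGaussian, integral_map (by fun_prop) (by fun_prop)]
  simp only [EuclideanSpace.real_norm_sq_eq]
  rw [integral_finsetSum]
  · have h : ∀ i : Fin n, ∫ x : Fin n → ℝ, x i ^ 2 ∂(Measure.pi fun _ => gaussianReal 0 1) = 1 :=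
      fun i => by
        rw [← integral_sq_gaussianReal]
        exact integral_comp_eval (μ := fun _ : Fin n => gaussianReal 0 1) (i := i)
          (f := fun x => x ^ 2) (by fun_prop)
    simp [h]
  · exact fun i _ => (measurePreserving_eval (fun _ : Fin n => gaussianReal 0 1)
      i).integrable_comp_of_integrable integrable_sq_gaussianReal

/-- The second moment of a `2`-homogeneous function under the standard Gaussian measure is
`n` times its average over the unit sphere. -/
theorem integral_stdGaussian_eq_average_sphere {n : ℕ} (hn : 1 ≤ n)
    (f : EuclideanSpace ℝ (Fin n) → ℝ) (hf : ∀ (r : ℝ) x, f (r • x) = r ^ 2 * f x) :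
    ∫ x, f x ∂stdGaussian (EuclideanSpace ℝ (Fin n)) =
      n * ⨍ ξ, f (ξ : EuclideanSpace ℝ (Fin n))
        ∂(volume : Measure (EuclideanSpace ℝ (Fin n))).toSphere := by
  have : NeZero n := ⟨by omega⟩
  obtain ⟨c, hc0, hc⟩ := stdGaussian_eq_withDensity (EuclideanSpace ℝ (Fin n))
  -- The radial factor is the same for every 2-homogeneous `g`. Testing with `‖x‖²`, of Gaussian
  -- mean `n` and equal to `1` on the sphere, eliminates it without computation.
  have key : ∀ g : EuclideanSpace ℝ (Fin n) → ℝ, (∀ (r : ℝ) x, g (r • x) = r ^ 2 * g x) →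
      ∫ x, g x ∂stdGaussian (EuclideanSpace ℝ (Fin n)) =
        (∫ ξ, g (ξ : EuclideanSpace ℝ (Fin n))
          ∂(volume : Measure (EuclideanSpace ℝ (Fin n))).toSphere) *
        ∫ r : Set.Ioi (0 : ℝ), (r : ℝ) ^ 2 * (c * Real.exp (-(1 / 2) * (r : ℝ) ^ 2))
          ∂.volumeIoiPow (Module.finrank ℝ (EuclideanSpace ℝ (Fin n)) - 1) := fun g hg => by
    rw [hc, integral_withDensity_eq_integral_toReal_smul (by fun_prop) (by simp),
      ← integral_homogeneous_mul_radial volume g (fun r => c * Real.exp (-(1 / 2) * r ^ 2)) hg]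
    refine integral_congr_ae (.of_forall fun x => ?_)
    simp only [smul_eq_mul]
    rw [ENNReal.toReal_ofReal (by positivity), mul_comm]
  have h1 := key (fun x => ‖x‖ ^ 2) fun r x => by
    rw [norm_smul, mul_pow, Real.norm_eq_abs, sq_abs]
  rw [integral_norm_sq_stdGaussian] at h1
  have hs : ∀ ξ : Metric.sphere (0 : EuclideanSpace ℝ (Fin n)) 1,
      ‖(ξ : EuclideanSpace ℝ (Fin n))‖ ^ 2 = 1 := fun ξ => by
    rw [norm_eq_of_mem_sphere ξ, one_pow]
  simp only [hs, integral_const, smul_eq_mul, mul_one] at h1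
  have hS : (volume : Measure (EuclideanSpace ℝ (Fin n))).toSphere.real Set.univ ≠ 0 := by
    intro h0
    rw [h0, zero_mul] at h1
    have : n = 0 := by exact_mod_cast h1
    omega
  rw [key f hf, average_eq, h1, smul_eq_mul, mul_mul_mul_comm, mul_inv_cancel₀ hS, one_mul,
    mul_comm]

/-- Both sides are centred Gaussian, and the tight-frame identity says that their covariances agree;
characteristic functions make this precise. -/
theorem map_sum_smul_gaussianReal {n N : ℕ} (z : Fin N → EuclideanSpace ℝ (Fin n)) (L : ℝ)
    (hz : ∀ ξ, ∑ i, (inner ℝ (z i) ξ) ^ 2 = L ^ 2 * ‖ξ‖ ^ 2) :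
    (Measure.pi fun _ : Fin N => gaussianReal 0 1).map (fun g => ∑ i, g i • z i) =
      (stdGaussian (EuclideanSpace ℝ (Fin n))).map (fun x => L • x) := by
  have hm : Measurable fun g : Fin N → ℝ => ∑ i, g i • z i := by fun_prop
  have : IsProbabilityMeasure
      ((Measure.pi fun _ : Fin N => gaussianReal 0 1).map fun g => ∑ i, g i • z i) :=
    Measure.isProbabilityMeasure_map hm.aemeasurable
  have : IsProbabilityMeasure
      ((stdGaussian (EuclideanSpace ℝ (Fin n))).map (fun x => L • x)) :=
    Measure.isProbabilityMeasure_map (by fun_prop)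
  refine Measure.ext_of_charFun ?_
  ext t
  rw [charFun_map_smul, charFun_stdGaussian, charFun_apply,
    integral_map hm.aemeasurable (by fun_prop)]
  have h1 : ∀ g : Fin N → ℝ, Complex.exp (inner ℝ (∑ i, g i • z i) t * Complex.I) =
      ∏ i, Complex.exp ((inner ℝ (z i) t : ℝ) * g i * Complex.I) := fun g => by
    rw [← Complex.exp_sum, sum_inner, Complex.ofReal_sum, Finset.sum_mul]
    congr 1
    refine Finset.sum_congr rfl fun i _ => ?_
    rw [real_inner_smul_left, Complex.ofReal_mul, mul_comm (g i : ℂ)]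
  simp only [h1]
  rw [integral_fintype_prod_eq_prod
    (f := fun i (x : ℝ) => Complex.exp ((inner ℝ (z i) t : ℝ) * x * Complex.I))]
  simp only [← charFun_apply_real, charFun_gaussianReal]
  rw [← Complex.exp_sum]
  congr 1
  rw [norm_smul]
  have h2 := congrArg (fun r : ℝ => (r : ℂ)) (hz t)
  push_cast at h2
  have h3 : (((‖L‖ * ‖t‖ : ℝ) : ℂ)) ^ 2 = (L : ℂ) ^ 2 * (‖t‖ : ℂ) ^ 2 := by
    rw [← Complex.ofReal_pow, mul_pow, Real.norm_eq_abs, sq_abs]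
    push_cast
    ring
  rw [h3, ← h2, neg_div, Finset.sum_div, ← Finset.sum_neg_distrib]
  refine Finset.sum_congr rfl fun i _ => ?_
  simp

end Gaussian

/-- Comparison of the type-2 average of a tight frame with the mean of the norm on the sphere. -/
theorem IsSymmConvexBody.sphereMean_sq_le_of_frame {n N : ℕ} (hn : 1 ≤ n)
    {K : Set (EuclideanSpace ℝ (Fin n))} (hK : IsSymmConvexBody K)
    (z : Fin N → EuclideanSpace ℝ (Fin n)) (L : ℝ)
    (hz : ∀ ξ, ∑ i, (inner ℝ (z i) ξ) ^ 2 = L ^ 2 * ‖ξ‖ ^ 2) :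
    n * L ^ 2 * sphereMean K ^ 2 ≤ typeTwoConst K ^ 2 * ∑ i, gauge K (z i) ^ 2 := by
  have : NeZero n := ⟨by omega⟩
  have hcont := hK.continuous_gauge
  have hmeas : ∀ μ : Measure (EuclideanSpace ℝ (Fin n)),
      AEStronglyMeasurable (fun x => gauge K x ^ 2) μ := fun μ =>
    (hcont.pow 2).aestronglyMeasurable
  have hhom : ∀ (r : ℝ) x, gauge K (r • x) ^ 2 = r ^ 2 * gauge K x ^ 2 := fun r x => by
    rw [hK.gauge_smul, mul_pow, sq_abs]
  have hJ : sphereMean K ^ 2 ≤ ⨍ ξ, gauge K (ξ : EuclideanSpace ℝ (Fin n)) ^ 2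
      ∂(volume : Measure (EuclideanSpace ℝ (Fin n))).toSphere := by
    have : NeZero (volume : Measure (EuclideanSpace ℝ (Fin n))).toSphere :=
      ⟨Measure.toSphere_ne_zero _⟩
    have hi : ∀ f : Metric.sphere (0 : EuclideanSpace ℝ (Fin n)) 1 → ℝ, Continuous f →
        Integrable f ((((volume : Measure (EuclideanSpace ℝ (Fin n))).toSphere) Set.univ)⁻¹ •
          (volume : Measure (EuclideanSpace ℝ (Fin n))).toSphere) := fun f hf =>
      hf.integrable_of_hasCompactSupport (HasCompactSupport.of_compactSpace f)
    exact sq_integral_le_integral_sq (hi _ (by fun_prop)) (hi _ (by fun_prop))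
  have hb := hK.exists_gauge_le_mul_norm
  obtain ⟨b, hb0, hb⟩ := hb
  have hint : Integrable (fun x => gauge K x ^ 2)
      (ProbabilityTheory.stdGaussian (EuclideanSpace ℝ (Fin n))) := by
    refine ((integrable_norm_sq_stdGaussian n).const_mul (b ^ 2)).mono'
      (hmeas _) (.of_forall fun x => ?_)
    rw [Real.norm_of_nonneg (sq_nonneg _), ← mul_pow]
    exact pow_le_pow_left₀ (gauge_nonneg _) (hb x) 2
  have hlaw := map_sum_smul_gaussianReal z L hz
  have hm : Measurable fun g : Fin N → ℝ => ∑ i, g i • z i := by fun_prop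
  have hint2 : Integrable (fun x => gauge K x ^ 2)
      ((ProbabilityTheory.stdGaussian (EuclideanSpace ℝ (Fin n))).map (fun x => L • x)) := by
    rw [integrable_map_measure (hmeas _) (by fun_prop)]
    simpa only [Function.comp_def, hhom] using hint.const_mul (L ^ 2)
  have hint3 : Integrable (fun g : Fin N → ℝ => gauge K (∑ i, g i • z i) ^ 2)
      (Measure.pi fun _ => ProbabilityTheory.gaussianReal 0 1) := by
    rw [← hlaw, integrable_map_measure (hmeas _) hm.aemeasurable] at hint2
    exact hint2
  have hE : ∫ g : Fin N → ℝ, gauge K (∑ i, g i • z i) ^ 2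
        ∂(Measure.pi fun _ => ProbabilityTheory.gaussianReal 0 1) =
      L ^ 2 * (n * ⨍ ξ, gauge K (ξ : EuclideanSpace ℝ (Fin n)) ^ 2
        ∂(volume : Measure (EuclideanSpace ℝ (Fin n))).toSphere) := by
    rw [← integral_map (f := fun x => gauge K x ^ 2) hm.aemeasurable
        (hmeas _), hlaw,
      integral_map (by fun_prop) (hmeas _)]
    simp only [hhom]
    rw [integral_const_mul, integral_stdGaussian_eq_average_sphere hn _ hhom]
  have hsymm : MeasurePreserving (fun v : ℝ => -v) (ProbabilityTheory.gaussianReal 0 1)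
      (ProbabilityTheory.gaussianReal 0 1) :=
    ⟨measurable_neg, by simpa using ProbabilityTheory.gaussianReal_map_neg (μ := 0) (v := 1)⟩
  -- Type 2 for the random vectors `gᵢ zᵢ`, using that the Gaussian scalars are symmetric and have
  -- unit second moment.
  have htype := hK.integral_gauge_sum_sq_le hsymm
    (fun i => LinearMap.toSpanSingleton ℝ _ (z i))
    (fun i => by
      simpa only [LinearMap.toSpanSingleton_apply, hhom] using
        integrable_sq_gaussianReal.mul_const (gauge K (z i) ^ 2))
    (by simpa only [LinearMap.toSpanSingleton_apply] using hint3)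
  simp only [LinearMap.toSpanSingleton_apply] at htype
  rw [hE] at htype
  simp only [hhom, integral_mul_const, integral_sq_gaussianReal, one_mul] at htype
  refine le_trans ?_ htype
  calc (n : ℝ) * L ^ 2 * sphereMean K ^ 2 = L ^ 2 * (n * sphereMean K ^ 2) := by ring
    _ ≤ _ := by gcongr

/-! ### Carathéodory: replacing a random vector by a finite frame. -/

section Discretization

variable {V : Type*} [NormedAddCommGroup V] [NormedSpace ℝ V] [FiniteDimensional ℝ V]

theorem sum_eq_sum_comp_embedding {ι κ M : Type*} [Fintype ι] [Fintype κ] [AddCommMonoid M]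
    (e : ι ↪ κ) (f : κ → M) (hf : ∀ k, k ∉ Set.range e → f k = 0) :
    ∑ k, f k = ∑ i, f (e i) := by
  rw [← Finset.sum_map Finset.univ e f]
  refine (Finset.sum_subset (Finset.subset_univ _) fun k _ hk => hf k ?_).symm
  simpa using hk

/-- Carathéodory's theorem, padded with zero weights to exactly `dim V + 1` points, so that the hull
of a compact set is a continuous image of a compact set. -/
theorem convexHull_eq_image_stdSimplex (S : Set V) :
    convexHull ℝ S = (fun p : (Fin (Module.finrank ℝ V + 1) → ℝ) ×
        (Fin (Module.finrank ℝ V + 1) → V) => ∑ k, p.1 k • p.2 k) ''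
      (stdSimplex ℝ (Fin (Module.finrank ℝ V + 1)) ×ˢ Set.univ.pi fun _ => S) := by
  refine Set.Subset.antisymm (fun x hx => ?_) ?_
  · obtain ⟨ι, hι, z, w, hz, haff, hw0, hw1, hsum⟩ := eq_pos_convex_span_of_mem_convexHull hx
    have hcard : Fintype.card ι ≤ Fintype.card (Fin (Module.finrank ℝ V + 1)) := by
      rw [Fintype.card_fin]
      exact haff.card_le_finrank_succ.trans
        (Nat.add_le_add_right (Submodule.finrank_le _) 1)
    obtain ⟨e⟩ := Function.Embedding.nonempty_of_card_le hcard
    obtain ⟨x₀, hx₀⟩ := convexHull_nonempty_iff.1 ⟨x, hx⟩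
    refine ⟨(Function.extend e w 0, Function.extend e z fun _ => x₀), ⟨⟨fun k => ?_, ?_⟩, ?_⟩, ?_⟩
    · simp only
      by_cases hk : k ∈ Set.range e
      · obtain ⟨i, rfl⟩ := hk
        rw [e.injective.extend_apply]
        exact (hw0 i).le
      · rw [Function.extend_apply' _ _ _ hk]
        rfl
    · simp only
      rw [sum_eq_sum_comp_embedding e _ fun k hk => by rw [Function.extend_apply' _ _ _ hk]; rfl]
      simpa [e.injective.extend_apply] using hw1
    · intro k _
      by_cases hk : k ∈ Set.range e
      · obtain ⟨i, rfl⟩ := hk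
        simp only [e.injective.extend_apply]
        exact hz ⟨i, rfl⟩
      · simp only [Function.extend_apply' _ _ _ hk]
        exact hx₀
    · simp only
      rw [sum_eq_sum_comp_embedding e _ fun k hk => by rw [Function.extend_apply' _ _ _ hk]; simp]
      simpa [e.injective.extend_apply] using hsum
  · rintro _ ⟨⟨w, z⟩, ⟨hw, hz⟩, rfl⟩
    exact (convex_convexHull ℝ S).sum_mem (fun k _ => hw.1 k) hw.2
      fun k _ => subset_convexHull ℝ S (hz k trivial)

theorem IsCompact.convexHull_of_finiteDimensional {S : Set V} (hS : IsCompact S) :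
    IsCompact (convexHull ℝ S) := by
  rw [convexHull_eq_image_stdSimplex]
  exact ((isCompact_stdSimplex ℝ _).prod (isCompact_univ_pi fun _ => hS)).image (by fun_prop)

/-- Finitely many moments of a bounded random vector agree with those of a finitely supported
one. -/
theorem exists_sum_eq_integral {E Ω : Type*} [TopologicalSpace E] [MeasurableSpace Ω]
    {μ : Measure Ω} [IsProbabilityMeasure μ] {S : Set E} (hS : IsCompact S) {Φ : E → V}
    (hΦ : Continuous Φ) {Y : Ω → E} (hY : ∀ᵐ ω ∂μ, Y ω ∈ S)
    (hint : Integrable (fun ω => Φ (Y ω)) μ) :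
    ∃ (N : ℕ) (w : Fin N → ℝ) (y : Fin N → E), (∀ k, 0 ≤ w k) ∧
      ∫ ω, Φ (Y ω) ∂μ = ∑ k, w k • Φ (y k) := by
  have hc := (hS.image hΦ).convexHull_of_finiteDimensional
  -- A mean lies in the closed convex hull; compactness makes the hull itself closed, hence the mean
  -- is a finite convex combination.
  have hmem := (convex_convexHull ℝ (Φ '' S)).integral_mem hc.isClosed
    (hY.mono fun ω hω => subset_convexHull ℝ _ (Set.mem_image_of_mem Φ hω)) hint
  rw [convexHull_eq_image_stdSimplex] at hmem
  obtain ⟨⟨w, z⟩, ⟨hw, hz⟩, hsum⟩ := hmem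
  choose y hy using fun k => hz k trivial
  refine ⟨_, w, y, hw.1, ?_⟩
  rw [← hsum]
  simp [fun k => (hy k).2]

end Discretization

theorem exists_sum_eq_integral_pair {E W Ω : Type*} [TopologicalSpace E] [NormedAddCommGroup W]
    [NormedSpace ℝ W] [FiniteDimensional ℝ W] [MeasurableSpace Ω] {μ : Measure Ω}
    [IsProbabilityMeasure μ] {S : Set E} (hS : IsCompact S) {Y : Ω → E}
    (hYm : AEStronglyMeasurable Y μ) (hY : ∀ᵐ ω ∂μ, Y ω ∈ S) {Q : E → W} (hQ : Continuous Q)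
    {p : E → ℝ} (hp : Continuous p) :
    ∃ (N : ℕ) (w : Fin N → ℝ) (y : Fin N → E), (∀ k, 0 ≤ w k) ∧
      (∀ ℓ : W →L[ℝ] ℝ, ∫ ω, ℓ (Q (Y ω)) ∂μ = ∑ k, w k * ℓ (Q (y k))) ∧
      ∫ ω, p (Y ω) ∂μ = ∑ k, w k * p (y k) := by
  have hΦ : Continuous fun y => (Q y, p y) := hQ.prodMk hp
  have hint : Integrable (fun ω => (Q (Y ω), p (Y ω))) μ := by
    obtain ⟨B, hB⟩ := (hS.image hΦ).isBounded.exists_norm_le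
    exact Integrable.of_bound (hΦ.comp_aestronglyMeasurable hYm) B
      (hY.mono fun ω hω => hB _ (Set.mem_image_of_mem _ hω))
  obtain ⟨N, w, y, hw, hsum⟩ := exists_sum_eq_integral hS hΦ hY hint
  have happ : ∀ ℓ : (W × ℝ) →L[ℝ] ℝ,
      ∫ ω, ℓ (Q (Y ω), p (Y ω)) ∂μ = ∑ k, w k * ℓ (Q (y k), p (y k)) := fun ℓ => by
    rw [ℓ.integral_comp_comm hint, hsum, map_sum]
    exact Finset.sum_congr rfl fun k _ => by rw [map_smul, smul_eq_mul]
  exact ⟨N, w, y, hw, fun ℓ => happ (ℓ.comp (ContinuousLinearMap.fst ℝ _ _)),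
    happ (ContinuousLinearMap.snd ℝ _ _)⟩

theorem exists_sum_eq_covariance {E Ω : Type*} [NormedAddCommGroup E] [InnerProductSpace ℝ E]
    [FiniteDimensional ℝ E] [MeasurableSpace Ω] {μ : Measure Ω} [IsProbabilityMeasure μ]
    {S : Set E} (hS : IsCompact S) {Y : Ω → E} (hYm : AEStronglyMeasurable Y μ)
    (hY : ∀ᵐ ω ∂μ, Y ω ∈ S) {p : E → ℝ} (hp : Continuous p) :
    ∃ (N : ℕ) (w : Fin N → ℝ) (y : Fin N → E), (∀ k, 0 ≤ w k) ∧
      (∀ ξ, ∫ ω, (inner ℝ (Y ω) ξ) ^ 2 ∂μ = ∑ k, w k * (inner ℝ (y k) ξ) ^ 2) ∧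
      ∫ ω, p (Y ω) ∂μ = ∑ k, w k * p (y k) := by
  -- The tensor `y ⊗ y` as a bilinear form: evaluated at `(ξ, ξ)` it gives `⟨y, ξ⟩²`, so one
  -- vector-valued mean encodes all directions.
  have h1 : Continuous fun y : E => (innerSL ℝ y).smulRight (innerSL ℝ y) :=
    ((ContinuousLinearMap.smulRightL ℝ E (E →L[ℝ] ℝ)).continuous.comp
      (innerSL ℝ).continuous).clm_apply (innerSL ℝ).continuous
  obtain ⟨N, w, y, hw, hQ, hp⟩ :=
    exists_sum_eq_integral_pair (W := E →L[ℝ] E →L[ℝ] ℝ) hS hYm hY h1 hp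
  refine ⟨N, w, y, hw, fun ξ => ?_, hp⟩
  have := hQ ((ContinuousLinearMap.apply ℝ ℝ ξ).comp (ContinuousLinearMap.apply ℝ (E →L[ℝ] ℝ) ξ))
  simpa [sq] using this

/-- For a bounded isotropic random vector `Y` with covariance `L²`, the second moment of `‖Y‖_K`
dominates `n L² M(K)²` up to the type-2 constant. -/
theorem IsSymmConvexBody.sphereMean_sq_le_integral {n : ℕ} (hn : 1 ≤ n)
    {K : Set (EuclideanSpace ℝ (Fin n))} (hK : IsSymmConvexBody K) {Ω : Type*}
    [MeasurableSpace Ω] {μ : Measure Ω} [IsProbabilityMeasure μ]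
    {S : Set (EuclideanSpace ℝ (Fin n))} (hS : IsCompact S) {Y : Ω → EuclideanSpace ℝ (Fin n)}
    (hYm : AEStronglyMeasurable Y μ) (hY : ∀ᵐ ω ∂μ, Y ω ∈ S) (L : ℝ)
    (hcov : ∀ ξ, ∫ ω, (inner ℝ (Y ω) ξ) ^ 2 ∂μ = L ^ 2 * ‖ξ‖ ^ 2) :
    n * L ^ 2 * sphereMean K ^ 2 ≤ typeTwoConst K ^ 2 * ∫ ω, gauge K (Y ω) ^ 2 ∂μ := by
  obtain ⟨N, w, y, hw, h1, h2⟩ :=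
    exists_sum_eq_covariance hS hYm hY (hK.continuous_gauge.pow 2)
  have h3 := hK.sphereMean_sq_le_of_frame hn (fun k => Real.sqrt (w k) • y k) L fun ξ => by
    rw [← hcov ξ, h1 ξ]
    refine Finset.sum_congr rfl fun k _ => ?_
    rw [real_inner_smul_left, mul_pow, Real.sq_sqrt (hw k)]
  refine h3.trans_eq ?_
  simp only [Pi.pow_apply] at h2
  rw [h2]
  congr 1
  refine Finset.sum_congr rfl fun k _ => ?_
  rw [hK.gauge_smul, mul_pow, sq_abs, Real.sq_sqrt (hw k)]

/-! ### Both bounds for uniform vectors in a symmetric body. -/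

section BodyMeasure

variable {n s : ℕ} {C : Set (EuclideanSpace ℝ (Fin n))}

theorem IsSymmConvexBody.measurableSet (hC : IsSymmConvexBody C) : MeasurableSet C :=
  hC.isCompact.measurableSet

theorem isProbabilityMeasure_restrict (hC1 : volume C = 1) :
    IsProbabilityMeasure (volume.restrict C) := ⟨by rw [Measure.restrict_apply_univ, hC1]⟩

theorem IsSymmConvexBody.measurePreserving_neg (hC : IsSymmConvexBody C) :
    MeasurePreserving (fun x : EuclideanSpace ℝ (Fin n) => -x)
      (volume.restrict C) (volume.restrict C) := by
  have h := (Measure.measurePreserving_neg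
    (volume : Measure (EuclideanSpace ℝ (Fin n)))).restrict_preimage hC.measurableSet
  have hpre : (Neg.neg ⁻¹' C : Set (EuclideanSpace ℝ (Fin n))) = C := hC.neg_eq
  rwa [hpre] at h

theorem pi_restrict_eq (C : Set (EuclideanSpace ℝ (Fin n))) :
    (volume : Measure (Fin s → EuclideanSpace ℝ (Fin n))).restrict (Set.univ.pi fun _ => C) =
      Measure.pi fun _ => volume.restrict C :=
  Measure.restrict_pi_pi _ _

theorem IsSymmConvexBody.integrable_pi (hC : IsSymmConvexBody C)
    {f : (Fin s → EuclideanSpace ℝ (Fin n)) → ℝ} (hf : Continuous f) :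
    Integrable f (Measure.pi fun _ => volume.restrict C) := by
  rw [← pi_restrict_eq]
  exact hf.continuousOn.integrableOn_compact (isCompact_univ_pi fun _ => hC.isCompact)

theorem IsSymmConvexBody.integrable_restrict (hC : IsSymmConvexBody C)
    {f : EuclideanSpace ℝ (Fin n) → ℝ} (hf : Continuous f) :
    Integrable f (volume.restrict C) :=
  hf.continuousOn.integrableOn_compact hC.isCompact

theorem IsSymmConvexBody.midpointPrekopaLeindler (hC : IsSymmConvexBody C) :
    MidpointPrekopaLeindler (volume.restrict C) :=
  (midpointPrekopaLeindler_euclideanSpace n).restrict hC.convex hC.measurableSet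

theorem multiIntegralNorm_eq (hC1 : volume C = 1) (K : Set (EuclideanSpace ℝ (Fin n)))
    (t : EuclideanSpace ℝ (Fin s)) :
    multiIntegralNorm (fun _ : Fin s => C) K t =
      ∫ x, gauge K (∑ j, t j • x j) ∂(Measure.pi fun _ : Fin s => volume.restrict C) := by
  rw [multiIntegralNorm, pi_restrict_eq]
  simp [Measure.real, hC1]

theorem multiIntegralNorm_nonneg (C : Fin s → Set (EuclideanSpace ℝ (Fin n)))
    (K : Set (EuclideanSpace ℝ (Fin n))) (t : EuclideanSpace ℝ (Fin s)) :
    0 ≤ multiIntegralNorm C K t :=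
  mul_nonneg (inv_nonneg.2 (Finset.prod_nonneg fun _ _ => measureReal_nonneg))
    (integral_nonneg fun _ => gauge_nonneg _)

variable {K : Set (EuclideanSpace ℝ (Fin n))}

theorem sq_multiIntegralNorm_le (hC : IsSymmConvexBody C) (hC1 : volume C = 1)
    (hK : IsSymmConvexBody K) (t : EuclideanSpace ℝ (Fin s)) :
    multiIntegralNorm (fun _ : Fin s => C) K t ^ 2 ≤
      typeTwoConst K ^ 2 * (‖t‖ ^ 2 * ∫ x in C, gauge K x ^ 2) := by
  have := isProbabilityMeasure_restrict hC1
  have hcont := hK.continuous_gauge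
  have hcs : Continuous fun x : Fin s → EuclideanSpace ℝ (Fin n) => gauge K (∑ j, t j • x j) :=
    hcont.comp (by fun_prop)
  rw [multiIntegralNorm_eq hC1]
  refine (sq_integral_le_integral_sq (hC.integrable_pi hcs)
    (hC.integrable_pi (hcs.pow 2))).trans ?_
  have h := hK.integral_gauge_sum_sq_le hC.measurePreserving_neg
    (fun j => t j • (LinearMap.id : EuclideanSpace ℝ (Fin n) →ₗ[ℝ] _))
    (fun j => hC.integrable_restrict ((hcont.comp
      (LinearMap.continuous_of_finiteDimensional _)).pow 2))
    (hC.integrable_pi (hcs.pow 2))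
  refine h.trans_eq ?_
  congr 1
  simp only [LinearMap.smul_apply, LinearMap.id_apply, hK.gauge_smul, mul_pow, sq_abs]
  simp only [integral_const_mul]
  rw [← Finset.sum_mul, EuclideanSpace.real_norm_sq_eq]

/-- Averaging over signs removes the cross terms, so the covariances of the summands add. -/
theorem integral_inner_sum_sq (hC : IsSymmConvexBody C) (hC1 : volume C = 1) {L : ℝ}
    (hL : ∀ ξ, ∫ x in C, (inner ℝ x ξ) ^ 2 = L ^ 2 * ‖ξ‖ ^ 2) (t : EuclideanSpace ℝ (Fin s))
    (ξ : EuclideanSpace ℝ (Fin n)) :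
    ∫ x, (inner ℝ (∑ j, t j • x j) ξ) ^ 2 ∂(Measure.pi fun _ : Fin s => volume.restrict C) =
      (L * ‖t‖) ^ 2 * ‖ξ‖ ^ 2 := by
  have := isProbabilityMeasure_restrict hC1
  rw [integral_pi_eq_integral_sum_signs hC.measurePreserving_neg
    (F := fun x => (inner ℝ (∑ j, t j • x j) ξ) ^ 2) (hC.integrable_pi (by fun_prop))]
  have h1 : ∀ x : Fin s → EuclideanSpace ℝ (Fin n),
      (∑ ε : Fin s → ℤˣ, (inner ℝ (∑ j, t j • (((ε j : ℤ) : ℝ) • x j)) ξ) ^ 2) / 2 ^ s =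
        ∑ j, t j ^ 2 * (inner ℝ (x j) ξ) ^ 2 := fun x => by
    have h2 := sum_units_norm_sq fun j => t j * inner ℝ (x j) ξ
    simp only [Real.norm_eq_abs, sq_abs, mul_pow, smul_eq_mul] at h2
    rw [div_eq_iff (by positivity), mul_comm _ ((2 : ℝ) ^ s), ← h2]
    refine Finset.sum_congr rfl fun ε _ => ?_
    rw [sum_inner]
    congr 1
    refine Finset.sum_congr rfl fun j _ => ?_
    rw [real_inner_smul_left, real_inner_smul_left]
    ring
  simp only [h1]
  rw [integral_finsetSum _ fun j _ => hC.integrable_pi (by fun_prop)]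
  have h3 : ∀ j : Fin s, ∫ x : Fin s → EuclideanSpace ℝ (Fin n),
      t j ^ 2 * (inner ℝ (x j) ξ) ^ 2 ∂(Measure.pi fun _ => volume.restrict C) =
        t j ^ 2 * (L ^ 2 * ‖ξ‖ ^ 2) := fun j => by
    rw [integral_const_mul, ← hL ξ]
    congr 1
    exact integral_comp_eval (μ := fun _ : Fin s => volume.restrict C) (i := j)
      (f := fun x => (inner ℝ x ξ) ^ 2) (by fun_prop)
  simp only [h3]
  rw [← Finset.sum_mul, ← EuclideanSpace.real_norm_sq_eq]
  ring

/-- The seminorm `x ↦ ‖∑ tⱼ xⱼ‖_K` on `(ℝⁿ)ˢ`. -/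
noncomputable def IsSymmConvexBody.sumSeminorm (hK : IsSymmConvexBody K)
    (t : EuclideanSpace ℝ (Fin s)) : Seminorm ℝ (Fin s → EuclideanSpace ℝ (Fin n)) :=
  hK.seminorm.comp (∑ j, t j • LinearMap.proj j)

theorem IsSymmConvexBody.sumSeminorm_apply (hK : IsSymmConvexBody K)
    (t : EuclideanSpace ℝ (Fin s)) (x : Fin s → EuclideanSpace ℝ (Fin n)) :
    hK.sumSeminorm t x = gauge K (∑ j, t j • x j) := by
  simp [sumSeminorm, seminorm_apply]

theorem integral_gauge_sum_sq_le_sq_multiIntegralNorm (hC : IsSymmConvexBody C)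
    (hC1 : volume C = 1) (hK : IsSymmConvexBody K) (t : EuclideanSpace ℝ (Fin s)) :
    ∫ x, gauge K (∑ j, t j • x j) ^ 2 ∂(Measure.pi fun _ : Fin s => volume.restrict C) ≤
      7200 * multiIntegralNorm (fun _ : Fin s => C) K t ^ 2 := by
  have := isProbabilityMeasure_restrict hC1
  have hcs : Continuous (hK.sumSeminorm (s := s) t) := by
    simp only [funext (hK.sumSeminorm_apply t)]
    exact hK.continuous_gauge.comp (by fun_prop)
  have h := (hC.midpointPrekopaLeindler.pi (s := s)).integral_sq_le (hK.sumSeminorm t)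
    hcs.measurable (hC.integrable_pi hcs) (hC.integrable_pi (hcs.pow 2))
  rw [multiIntegralNorm_eq hC1]
  simpa only [hK.sumSeminorm_apply] using h

theorem sphereMean_nonneg (K : Set (EuclideanSpace ℝ (Fin n))) : 0 ≤ sphereMean K := by
  rw [sphereMean, average_eq]
  exact smul_nonneg (inv_nonneg.2 measureReal_nonneg) (integral_nonneg fun _ => gauge_nonneg _)

theorem multiIntegralNorm_ge (hn : 1 ≤ n) (hC : IsSymmConvexBody C) (hC1 : volume C = 1)
    (hK : IsSymmConvexBody K) {L : ℝ} (hL0 : 0 ≤ L)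
    (hL : ∀ ξ, ∫ x in C, (inner ℝ x ξ) ^ 2 = L ^ 2 * ‖ξ‖ ^ 2) (t : EuclideanSpace ℝ (Fin s)) :
    1 / 100 * L * Real.sqrt n * sphereMean K / typeTwoConst K * ‖t‖ ≤
      multiIntegralNorm (fun _ : Fin s => C) K t := by
  have := isProbabilityMeasure_restrict hC1
  have hm0 := multiIntegralNorm_nonneg (fun _ : Fin s => C) K t
  have hM0 := sphereMean_nonneg K
  -- If the type-2 constant were zero, the quotient would be zero by convention and the bound
  -- trivial.
  rcases (typeTwoConst_nonneg (K := K)).eq_or_lt with hT | hT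
  · simpa [← hT] using hm0
  have hcY : Continuous fun x : Fin s → EuclideanSpace ℝ (Fin n) => ∑ j, t j • x j := by fun_prop
  have hY : ∀ᵐ x ∂(Measure.pi fun _ : Fin s => volume.restrict C),
      ∑ j, t j • x j ∈ (fun x : Fin s → EuclideanSpace ℝ (Fin n) => ∑ j, t j • x j) ''
        Set.univ.pi fun _ => C := by
    rw [← pi_restrict_eq]
    filter_upwards [ae_restrict_mem (MeasurableSet.univ_pi fun _ => hC.measurableSet)] with x hx
    exact ⟨x, hx, rfl⟩
  have h1 := hK.sphereMean_sq_le_integral hn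
    ((isCompact_univ_pi fun _ => hC.isCompact).image hcY) hcY.aestronglyMeasurable hY
    (L * ‖t‖) (integral_inner_sum_sq hC hC1 hL t)
  have h2 := integral_gauge_sum_sq_le_sq_multiIntegralNorm hC hC1 hK t
  set m := multiIntegralNorm (fun _ : Fin s => C) K t
  set T := typeTwoConst K
  have h3 : (L * Real.sqrt n * sphereMean K * ‖t‖) ^ 2 ≤ (100 * T * m) ^ 2 := by
    calc (L * Real.sqrt n * sphereMean K * ‖t‖) ^ 2
        = n * (L * ‖t‖) ^ 2 * sphereMean K ^ 2 := by
          rw [mul_pow, mul_pow, mul_pow, Real.sq_sqrt n.cast_nonneg]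
          ring
      _ ≤ T ^ 2 * (7200 * m ^ 2) := h1.trans (by gcongr)
      -- The constant `100` comes from `7200 ≤ 100²`.
      _ ≤ (100 * T * m) ^ 2 := by nlinarith [sq_nonneg (T * m)]
  have h4 := (sq_le_sq₀ (by positivity) (by positivity)).1 h3
  rw [div_mul_eq_mul_div, div_le_iff₀ hT]
  linarith

/-- The parameter `I` serves two cases: `∫_C ‖x‖_K` for general bodies and `1` for `C = K`. -/
theorem multiIntegralNorm_le_of_integral_sq_le (hC : IsSymmConvexBody C) (hC1 : volume C = 1)
    (hK : IsSymmConvexBody K) {I : ℝ} (hI0 : 0 ≤ I)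
    (hI : ∫ x in C, gauge K x ^ 2 ≤ 7200 * I ^ 2) (t : EuclideanSpace ℝ (Fin s)) :
    multiIntegralNorm (fun _ : Fin s => C) K t ≤ 100 * typeTwoConst K * I * ‖t‖ := by
  have hT := typeTwoConst_nonneg (K := K)
  refine (sq_le_sq₀ (multiIntegralNorm_nonneg _ _ _) (by positivity)).1 ?_
  calc multiIntegralNorm (fun _ : Fin s => C) K t ^ 2
      ≤ typeTwoConst K ^ 2 * (‖t‖ ^ 2 * ∫ x in C, gauge K x ^ 2) :=
        sq_multiIntegralNorm_le hC hC1 hK t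
    _ ≤ typeTwoConst K ^ 2 * (‖t‖ ^ 2 * (7200 * I ^ 2)) := by gcongr
    _ ≤ (100 * typeTwoConst K * I * ‖t‖) ^ 2 := by
        nlinarith [sq_nonneg (typeTwoConst K * I * ‖t‖)]

theorem integral_gauge_sq_le (hC : IsSymmConvexBody C) (hC1 : volume C = 1)
    (hK : IsSymmConvexBody K) :
    ∫ x in C, gauge K x ^ 2 ≤ 7200 * (∫ x in C, gauge K x) ^ 2 := by
  have := isProbabilityMeasure_restrict hC1
  have hc : Continuous hK.seminorm := hK.continuous_gauge
  exact hC.midpointPrekopaLeindler.integral_sq_le hK.seminorm hc.measurable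
    (hC.integrable_restrict hc) (hC.integrable_restrict (hc.pow 2))

theorem IsIsotropicWith.integral_inner_sq {L : ℝ} (hC : IsIsotropicWith C L)
    (ξ : EuclideanSpace ℝ (Fin n)) : ∫ x in C, (inner ℝ x ξ) ^ 2 = L ^ 2 * ‖ξ‖ ^ 2 := by
  rcases eq_or_ne ξ 0 with rfl | hξ
  · simp
  have hξ' : ‖ξ‖ ≠ 0 := norm_ne_zero_iff.2 hξ
  rw [← hC.second_moment (‖ξ‖⁻¹ • ξ) (by rw [norm_smul, norm_inv, norm_norm, inv_mul_cancel₀ hξ'])]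
  simp only [real_inner_smul_right, mul_pow]
  rw [integral_const_mul]
  field_simp

end BodyMeasure

/-! ### Invariance under linear maps. -/

section LinearImage

variable {n s : ℕ} {K : Set (EuclideanSpace ℝ (Fin n))}

theorem gauge_image_linearEquiv {E F : Type*} [AddCommGroup E] [Module ℝ E] [AddCommGroup F]
    [Module ℝ F] (T : E ≃ₗ[ℝ] F) (K : Set E) (x : E) : gauge (T '' K) (T x) = gauge K x := by
  rw [gauge_def', gauge_def']
  simp only [← map_smul, T.injective.mem_set_image]

theorem rademacherSq_image (T : EuclideanSpace ℝ (Fin n) ≃ₗ[ℝ] EuclideanSpace ℝ (Fin n)) {k : ℕ}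
    (x : Fin k → EuclideanSpace ℝ (Fin n)) :
    rademacherSq (T '' K) (fun i => T (x i)) = rademacherSq K x := by
  simp only [rademacherSq, ← map_smul, ← map_sum, gauge_image_linearEquiv]

/-- `T` is an isometry from `X_K` onto `X_{T(K)}`, so the admissible constants coincide for each
`k`. -/
theorem typeTwoConst_image (T : EuclideanSpace ℝ (Fin n) ≃ₗ[ℝ] EuclideanSpace ℝ (Fin n)) :
    typeTwoConst (T '' K) = typeTwoConst K := by
  unfold typeTwoConst typeTwoConstOn
  congr! 4 with k
  ext C
  refine and_congr_right fun _ => ?_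
  rw [← (Equiv.arrowCongr (Equiv.refl (Fin k)) T.toEquiv).forall_congr_right]
  refine forall_congr' fun x => ?_
  have h : rademacherSq (T '' K) ((Equiv.arrowCongr (Equiv.refl (Fin k)) T.toEquiv) x) =
      rademacherSq K x := rademacherSq_image T x
  rw [h]
  simp only [Equiv.arrowCongr_apply, Equiv.refl_symm, Equiv.coe_refl, Function.comp_def, id,
    LinearEquiv.coe_toEquiv, gauge_image_linearEquiv]

theorem IsSymmConvexBody.image (hK : IsSymmConvexBody K)
    (T : EuclideanSpace ℝ (Fin n) ≃ₗ[ℝ] EuclideanSpace ℝ (Fin n)) :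
    IsSymmConvexBody (T '' K) where
  isCompact := hK.isCompact.image T.toContinuousLinearEquiv.continuous
  convex := hK.convex.linear_image T.toLinearMap
  interior_nonempty := by
    have h := T.toContinuousLinearEquiv.toHomeomorph.image_interior K
    change T '' interior K = interior (T '' K) at h
    rw [← h]
    exact hK.interior_nonempty.image _
  neg_eq := by
    ext x
    constructor
    · rintro ⟨y, hy, hx⟩
      exact ⟨-y, hK.neg_mem y hy, by rw [map_neg, hx, neg_neg]⟩
    · rintro ⟨y, hy, rfl⟩
      exact ⟨-y, hK.neg_mem y hy, by rw [map_neg]⟩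

theorem volume_image_linearEquiv (T : EuclideanSpace ℝ (Fin n) ≃ₗ[ℝ] EuclideanSpace ℝ (Fin n))
    (A : Set (EuclideanSpace ℝ (Fin n))) :
    volume (T '' A) = ENNReal.ofReal |LinearMap.det (T : EuclideanSpace ℝ (Fin n) →ₗ[ℝ] _)| *
      volume A :=
  Measure.addHaar_image_linearMap volume (T : EuclideanSpace ℝ (Fin n) →ₗ[ℝ] _) A

/-- Equality of the two volumes forces `|det T| = 1`. -/
theorem measurePreserving_restrict_image (hK1 : volume K = 1)
    (T : EuclideanSpace ℝ (Fin n) ≃ₗ[ℝ] EuclideanSpace ℝ (Fin n)) (hT1 : volume (T '' K) = 1) :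
    MeasurePreserving T (volume.restrict K) (volume.restrict (T '' K)) := by
  have hdet : ENNReal.ofReal |LinearMap.det (T : EuclideanSpace ℝ (Fin n) →ₗ[ℝ] _)| = 1 := by
    rw [volume_image_linearEquiv, hK1, mul_one] at hT1
    exact hT1
  have hTm : Measurable T := T.toContinuousLinearEquiv.continuous.measurable
  have hmp : MeasurePreserving T volume volume := by
    refine ⟨hTm, Measure.ext fun A hA => ?_⟩
    rw [Measure.map_apply hTm hA]
    conv_rhs => rw [← Set.image_preimage_eq A T.surjective]
    rw [volume_image_linearEquiv, hdet, one_mul]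
  exact hmp.restrict_image_emb
    T.toContinuousLinearEquiv.toHomeomorph.measurableEmbedding K

theorem multiIntegralNorm_image (hK : IsSymmConvexBody K) (hK1 : volume K = 1)
    (T : EuclideanSpace ℝ (Fin n) ≃ₗ[ℝ] EuclideanSpace ℝ (Fin n)) (hT1 : volume (T '' K) = 1)
    (t : EuclideanSpace ℝ (Fin s)) :
    multiIntegralNorm (fun _ : Fin s => T '' K) (T '' K) t =
      multiIntegralNorm (fun _ : Fin s => K) K t := by
  have := isProbabilityMeasure_restrict hK1
  have := isProbabilityMeasure_restrict hT1
  have hmp := measurePreserving_pi (fun _ : Fin s => volume.restrict K)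
    (fun _ : Fin s => volume.restrict (T '' K))
    fun _ => measurePreserving_restrict_image hK1 T hT1
  rw [multiIntegralNorm_eq hK1, multiIntegralNorm_eq hT1, ← hmp.map_eq,
    integral_map hmp.measurable.aemeasurable]
  · simp only [← map_smul, ← map_sum, gauge_image_linearEquiv]
  · exact ((hK.image T).continuous_gauge.comp (by fun_prop)).aestronglyMeasurable

end LinearImage

/-! ### Existence of the isotropic position. -/

section IsotropicPosition

variable {n : ℕ} {K : Set (EuclideanSpace ℝ (Fin n))}

/-- Otherwise almost all of `K` would lie in the null hyperplane `v⊥`. -/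
theorem integral_inner_sq_pos (hK : IsSymmConvexBody K) (hK1 : volume K = 1)
    {v : EuclideanSpace ℝ (Fin n)} (hv : v ≠ 0) : 0 < ∫ x in K, (inner ℝ x v) ^ 2 := by
  refine lt_of_le_of_ne (integral_nonneg fun x => sq_nonneg _) fun h0 => ?_
  have h1 := (integral_eq_zero_iff_of_nonneg (fun x => sq_nonneg _)
    (hK.integrable_restrict (f := fun x => (inner ℝ x v) ^ 2) (by fun_prop))).1 h0.symm
  have h2 : ∀ᵐ x ∂volume.restrict K, x ∉ (((ℝ ∙ v)ᗮ : Submodule ℝ (EuclideanSpace ℝ (Fin n))) :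
      Set (EuclideanSpace ℝ (Fin n))) := by
    refine ae_restrict_of_ae (measure_eq_zero_iff_ae_notMem.1 (Measure.addHaar_submodule _ _ ?_))
    intro htop
    have : v ∈ (ℝ ∙ v)ᗮ := by
      rw [htop]
      trivial
    exact hv (inner_self_eq_zero.1 ((Submodule.mem_orthogonal_singleton_iff_inner_left).1 this))
  have h3 : ∀ᵐ x ∂volume.restrict K, False := by
    filter_upwards [h1, h2] with x hx1 hx2
    refine hx2 ((Submodule.mem_orthogonal_singleton_iff_inner_left).2 ?_)
    simpa using hx1
  have := isProbabilityMeasure_restrict hK1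
  exact IsProbabilityMeasure.ne_zero (volume.restrict K) (by simpa using h3)

theorem setIntegral_id_eq_zero (hK : IsSymmConvexBody K) : ∫ x in K, x = 0 := by
  have hm := hK.measurePreserving_neg
  have h := hm.integral_comp (Homeomorph.neg _).measurableEmbedding
    fun x : EuclideanSpace ℝ (Fin n) => x
  rw [integral_neg] at h
  have h2 : (2 : ℝ) • ∫ x in K, x = 0 := by
    rw [two_smul]
    exact add_eq_zero_iff_eq_neg.2 h.symm
  exact (smul_eq_zero.1 h2).resolve_left two_ne_zero

/-- The covariance form of a body. -/
noncomputable def covarianceForm (hK : IsSymmConvexBody K) :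
    LinearMap.BilinForm ℝ (EuclideanSpace ℝ (Fin n)) :=
  LinearMap.mk₂ ℝ (fun u v => ∫ x in K, inner ℝ x u * inner ℝ x v)
    (fun u u' v => by
      simp only [inner_add_right, add_mul]
      exact integral_add (hK.integrable_restrict (by fun_prop))
        (hK.integrable_restrict (by fun_prop)))
    (fun c u v => by
      simp only [real_inner_smul_right, mul_assoc]
      exact integral_const_mul _ _)
    (fun u v v' => by
      simp only [inner_add_right, mul_add]
      exact integral_add (hK.integrable_restrict (by fun_prop))
        (hK.integrable_restrict (by fun_prop)))
    (fun c u v => by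
      simp only [real_inner_smul_right, mul_left_comm _ c]
      exact integral_const_mul _ _)

theorem covarianceForm_apply (hK : IsSymmConvexBody K) (u v : EuclideanSpace ℝ (Fin n)) :
    covarianceForm hK u v = ∫ x in K, inner ℝ x u * inner ℝ x v := rfl

theorem covarianceForm_self (hK : IsSymmConvexBody K) (v : EuclideanSpace ℝ (Fin n)) :
    covarianceForm hK v v = ∫ x in K, (inner ℝ x v) ^ 2 := by
  simp only [covarianceForm_apply, sq]

theorem exists_basis_orthogonal_covariance (hK : IsSymmConvexBody K) :
    ∃ v : Module.Basis (Fin n) ℝ (EuclideanSpace ℝ (Fin n)),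
      ∀ i j, i ≠ j → covarianceForm hK (v i) (v j) = 0 := by
  have hsymm : LinearMap.IsSymm (covarianceForm hK) := ⟨fun u v => by
    simp only [covarianceForm_apply, mul_comm, RingHom.id_apply]⟩
  obtain ⟨v, hv⟩ := LinearMap.BilinForm.exists_orthogonal_basis hsymm
  have hfr : Module.finrank ℝ (EuclideanSpace ℝ (Fin n)) = n := finrank_euclideanSpace_fin
  refine ⟨v.reindex (finCongr hfr), fun i j hij => ?_⟩
  simp only [Module.Basis.reindex_apply]
  exact hv ((finCongr hfr).symm.injective.ne hij)

theorem exists_linearEquiv_whitening (hK : IsSymmConvexBody K) (hK1 : volume K = 1) :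
    ∃ T : EuclideanSpace ℝ (Fin n) ≃ₗ[ℝ] EuclideanSpace ℝ (Fin n),
      ∀ ξ, ∫ x in K, (inner ℝ (T x) ξ) ^ 2 = ‖ξ‖ ^ 2 := by
  obtain ⟨v, hv⟩ := exists_basis_orthogonal_covariance hK
  have hpos : ∀ i, 0 < covarianceForm hK (v i) (v i) := fun i => by
    rw [covarianceForm_self]
    exact integral_inner_sq_pos hK hK1 (v.ne_zero i)
  set β : Fin n → ℝ := fun i => (Real.sqrt (covarianceForm hK (v i) (v i)))⁻¹ with hβ
  have hβ0 : ∀ i, β i ≠ 0 := fun i => inv_ne_zero (Real.sqrt_pos.2 (hpos i)).ne'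
  have hβ2 : ∀ i, β i * β i * covarianceForm hK (v i) (v i) = 1 := fun i => by
    rw [hβ, ← mul_inv, Real.mul_self_sqrt (hpos i).le, inv_mul_cancel₀ (hpos i).ne']
  -- The coordinates are `⟨βᵢ vᵢ, x⟩` with `βᵢ vᵢ` orthonormal for the covariance form, so on `K`
  -- they are uncorrelated with unit second moment.
  let T₀ : EuclideanSpace ℝ (Fin n) →ₗ[ℝ] EuclideanSpace ℝ (Fin n) :=
    (WithLp.linearEquiv 2 ℝ (Fin n → ℝ)).symm.toLinearMap ∘ₗ
      LinearMap.pi fun i => β i • (innerₗ _ (v i))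
  have hT₀ : ∀ x i, T₀ x i = β i * inner ℝ (v i) x := fun x i => by simp [T₀]
  have hinj : Function.Injective T₀ := by
    rw [← LinearMap.ker_eq_bot, LinearMap.ker_eq_bot']
    intro x hx
    have h0 : innerₗ (EuclideanSpace ℝ (Fin n)) x = 0 := v.ext fun i => by
      have h1 := hT₀ x i
      rw [hx] at h1
      rw [innerₗ_apply_apply, real_inner_comm]
      exact (mul_eq_zero.1 h1.symm).resolve_left (hβ0 i)
    exact inner_self_eq_zero.1 (LinearMap.congr_fun h0 x)
  refine ⟨LinearEquiv.ofInjectiveEndo T₀ hinj, fun ξ => ?_⟩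
  have h1 : ∀ x, inner ℝ (T₀ x) ξ = inner ℝ x (∑ i, (ξ i * β i) • v i) := fun x => by
    rw [inner_sum, PiLp.inner_apply]
    refine Finset.sum_congr rfl fun i _ => ?_
    rw [hT₀, real_inner_smul_right, real_inner_comm x (v i)]
    simp only [RCLike.inner_apply, conj_trivial]
    ring
  simp only [LinearEquiv.coe_ofInjectiveEndo, h1]
  rw [← covarianceForm_self hK, EuclideanSpace.real_norm_sq_eq]
  simp only [map_sum, LinearMap.sum_apply, map_smul, LinearMap.smul_apply, smul_eq_mul]
  refine Finset.sum_congr rfl fun i _ => ?_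
  rw [Finset.sum_eq_single i]
  · linear_combination (ξ i ^ 2) * hβ2 i
  · intro j _ hj
    rw [hv _ _ hj]
    ring
  · simp

theorem exists_isotropic_image (hn : 1 ≤ n) (hK : IsSymmConvexBody K) (hK1 : volume K = 1) :
    ∃ (T : EuclideanSpace ℝ (Fin n) ≃ₗ[ℝ] EuclideanSpace ℝ (Fin n)) (L : ℝ),
      IsIsotropicWith (T '' K) L := by
  obtain ⟨T, hT⟩ := exists_linearEquiv_whitening hK hK1
  set d := |LinearMap.det (T : EuclideanSpace ℝ (Fin n) →ₗ[ℝ] _)| with hd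
  have hd0 : 0 < d := abs_pos.2 (LinearEquiv.isUnit_det' T).ne_zero
  -- Scaling by `c` restores volume `1`; since `T` has made the covariance the identity, `c` is also
  -- the isotropic constant.
  set c : ℝ := (d⁻¹) ^ ((n : ℝ)⁻¹) with hc
  have hc0 : 0 < c := Real.rpow_pos_of_pos (inv_pos.2 hd0) _
  have hcn : c ^ n = d⁻¹ := Real.rpow_inv_natCast_pow (inv_pos.2 hd0).le (by omega)
  let S : EuclideanSpace ℝ (Fin n) ≃ₗ[ℝ] EuclideanSpace ℝ (Fin n) :=
    T.trans (LinearEquiv.smulOfNeZero ℝ _ c hc0.ne')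
  have hS : ∀ x, S x = c • T x := fun x => rfl
  have hS1 : volume (S '' K) = 1 := by
    have : S '' K = c • (T '' K) := by
      rw [← Set.image_smul, Set.image_image]
      rfl
    rw [this, Measure.addHaar_smul, volume_image_linearEquiv, hK1, mul_one, finrank_euclideanSpace_fin,
      hcn, ← hd, ← ENNReal.ofReal_mul (abs_nonneg _), abs_of_pos (inv_pos.2 hd0),
      inv_mul_cancel₀ hd0.ne', ENNReal.ofReal_one]
  have hSK := hK.image S
  refine ⟨S, c, ⟨hSK.toIsConvexBodyIn, hS1, setIntegral_id_eq_zero hSK, hc0, fun ξ hξ => ?_⟩⟩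
  have hmp := measurePreserving_restrict_image hK1 S hS1
  rw [← hmp.map_eq, integral_map hmp.measurable.aemeasurable
    (by fun_prop)]
  simp only [hS, real_inner_smul_left, mul_pow]
  rw [integral_const_mul, hT, hξ]
  ring

end IsotropicPosition

/-! ### Assembly of the two parts. -/

theorem mainTheorem11 :
    ∃ c₁ c₂ : ℝ, 0 < c₁ ∧ 0 < c₂ ∧
      -- general bodies `C` and `K`
      (∀ n : ℕ, 1 ≤ n → ∀ (C K : Set (EuclideanSpace ℝ (Fin n))) (L : ℝ),
        IsSymmConvexBody C → IsIsotropicWith C L → IsSymmConvexBody K →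
        ∀ s : ℕ, 1 ≤ s → ∀ t : EuclideanSpace ℝ (Fin s),
          c₁ * L * Real.sqrt n * sphereMean K / typeTwoConst K * ‖t‖
              ≤ multiIntegralNorm (fun _ : Fin s => C) K t ∧
            multiIntegralNorm (fun _ : Fin s => C) K t
              ≤ c₂ * typeTwoConst K * (∫ x in C, gauge K x) * ‖t‖) ∧
      -- the case `C = K`, with `T '' K` an isotropic image of `K`
      (∀ n : ℕ, 1 ≤ n → ∀ K : Set (EuclideanSpace ℝ (Fin n)),
        IsSymmConvexBody K → volume K = 1 →
        (∃ (T : EuclideanSpace ℝ (Fin n) ≃ₗ[ℝ] EuclideanSpace ℝ (Fin n)) (L : ℝ),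
          IsIsotropicWith (T '' K) L) ∧
        ∀ s : ℕ, 1 ≤ s → ∀ t : EuclideanSpace ℝ (Fin s),
          (∀ (T : EuclideanSpace ℝ (Fin n) ≃ₗ[ℝ] EuclideanSpace ℝ (Fin n)) (L : ℝ),
            IsIsotropicWith (T '' K) L →
              c₁ * L * Real.sqrt n * sphereMean (T '' K) / typeTwoConst K * ‖t‖
                ≤ multiIntegralNorm (fun _ : Fin s => K) K t) ∧
            multiIntegralNorm (fun _ : Fin s => K) K t ≤ c₂ * typeTwoConst K * ‖t‖) := by
  refine ⟨1 / 100, 100, by norm_num, by norm_num, ?_, ?_⟩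
  · intro n hn C K L hC hiso hK s _ t
    refine ⟨multiIntegralNorm_ge hn hC hiso.volume_eq_one hK hiso.const_pos.le
      hiso.integral_inner_sq t, ?_⟩
    exact multiIntegralNorm_le_of_integral_sq_le hC hiso.volume_eq_one hK
      (integral_nonneg fun _ => gauge_nonneg _)
      (integral_gauge_sq_le hC hiso.volume_eq_one hK) t
  · intro n hn K hK hK1
    refine ⟨exists_isotropic_image hn hK hK1, fun s _ t => ⟨fun T L hiso => ?_, ?_⟩⟩
    -- The general lower bound is applied with both bodies equal to `T(K)` and then pulled back to
    -- `K`.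
    · have h := multiIntegralNorm_ge hn (hK.image T) hiso.volume_eq_one (hK.image T)
        hiso.const_pos.le hiso.integral_inner_sq t
      rwa [typeTwoConst_image, multiIntegralNorm_image hK hK1 T hiso.volume_eq_one] at h
    · have hprob := isProbabilityMeasure_restrict hK1
      have h1 : ∫ x in K, gauge K x ^ 2 ≤ ∫ _x in K, (1 : ℝ) := by
        refine setIntegral_mono_on (hK.integrable_restrict (hK.continuous_gauge.pow 2))
          (integrable_const _) hK.measurableSet fun x hx => ?_
        exact pow_le_one₀ (gauge_nonneg _) (gauge_le_one_of_mem hx)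
      have h2 := multiIntegralNorm_le_of_integral_sq_le hK hK1 hK (I := 1) zero_le_one
        (by
          rw [integral_const, probReal_univ, one_smul] at h1
          linarith) t
      simpa using h2
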